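/- For $n\in\mathbb{N}$ let $G(n)=\sum_{m_1+m_2=n}\Lambda(m_1)\Lambda(m_2)$, where $\Lambda$ is the von Mangoldt function and $m_1,m_2$ run over positive integers. Let $J(n)=n\,C_2\prod_{p\mid n,\ p>2}\frac{p-1}{p-2}$ for even $n$ and $J(n)=0$ for odd $n$, where $C_2=2\prod_{p>2}\bigl(1-\frac{1}{(p-1)^2}\bigr)$ and $p$ denotes primes. Then the Riemann Hypothesis holds if and only if $$\sum_{n\le x}\bigl(G(n)-J(n)\bigr)\ll x^{3/2+o(1)}\qquad (x\to\infty),$$ that is, if and only if for every $\varepsilon>0$ one has $\sum_{n\le x}(G(n)-J(n))=O_\varepsilon(x^{3/2+\varepsilon})$ as $x\to\infty$. -/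

import Mathlib

open Filter Asymptotics

noncomputable section

/-- The weighted Goldbach function `G(n) = ∑_{m₁ + m₂ = n} Λ(m₁) Λ(m₂)`
(pairs with a zero entry contribute nothing, since `Λ(0) = 0`). -/
def goldbachG (n : ℕ) : ℝ :=
  ∑ m ∈ Finset.HasAntidiagonal.antidiagonal n,
    ArithmeticFunction.vonMangoldt m.1 * ArithmeticFunction.vonMangoldt m.2

/-- The twin prime constant `C₂ = 2 ∏_{p > 2} (1 - 1 / (p - 1)²)`, the product being over primes. -/
def twinPrimeC2 : ℝ :=
  2 * ∏' p : {p : ℕ // p.Prime ∧ 2 < p}, (1 - 1 / ((p : ℝ) - 1) ^ 2)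

/-- The product defining `twinPrimeC2` converges absolutely. -/
theorem multipliable_twinPrimeC2 :
    Multipliable fun p : {p : ℕ // p.Prime ∧ 2 < p} => (1 - 1 / ((p : ℝ) - 1) ^ 2) := by
  have h1 : Summable fun n : ℕ => 1 / (n : ℝ) ^ 2 :=
    Real.summable_one_div_nat_pow.mpr one_lt_two
  have h2 : Summable fun p : {p : ℕ // p.Prime ∧ 2 < p} => 1 / (((p : ℕ) - 1 : ℕ) : ℝ) ^ 2 := by
    refine h1.comp_injective (i := fun p : {p : ℕ // p.Prime ∧ 2 < p} => (p : ℕ) - 1) ?_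
    intro a b hab
    have ha := a.2.2
    have hb := b.2.2
    apply Subtype.ext
    dsimp only at hab
    omega
  have h3 : Summable fun p : {p : ℕ // p.Prime ∧ 2 < p} => -(1 / ((p : ℝ) - 1) ^ 2) := by
    refine h2.neg.congr fun p => ?_
    have hp := p.2.2
    rw [Nat.cast_sub (by omega), Nat.cast_one]
  simpa [sub_eq_add_neg] using Real.multipliable_one_add_of_summable h3

/-- The Hardy–Littlewood main term: `J(n) = n C₂ ∏_{p ∣ n, p > 2} (p - 1) / (p - 2)` for even `n`,
and `J(n) = 0` for odd `n`. -/
def hardyLittlewoodJ (n : ℕ) : ℝ :=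
  if Even n then
    n * twinPrimeC2 * ∏ p ∈ n.primeFactors with 2 < p, ((p : ℝ) - 1) / ((p : ℝ) - 2)
  else 0

end

/-! The function J is an average-neutral model: its partial sums are N²/2 + O(N^{3/2})
unconditionally (`exists_abs_sum_hardyLittlewoodJ_sub_le`). Hence the claim concerns only how well
∑_{n≤N} G(n) is approximated by N²/2. Zeros are handled through `riemannZeta₁`, the entire function
equal to (s-1)ζ(s) away from s = 1 and nonzero there; RH amounts to its having no zero with Re s >
1/2 (`riemannHypothesis_of_ne_zero`, `riemannZeta₁_ne_zero_of_riemannHypothesis`).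

From the Goldbach average to RH: with F(r) = ∑ Λ(n)e^{-nr} and y(r) = ∑_{n≥1} e^{-nr}, the bound on
averages gives F² - y² = O(r^{-3/2-ε}) as r → 0. Both F and y are nonnegative and y is of size 1/r,
so dividing by F + y yields F - y = O(r^{-1/2-ε}) (`expSeries_mangoldtSubOne_isBigO`). Therefore the
Mellin transform of F - y, which is Γ(s)(-ζ'/ζ(s) - ζ(s)) for Re s > 1, is holomorphic for Re s >
1/2; a zero of ζ there would produce a pole (`riemannZeta₁_ne_zero_of_isBigO`).

From RH to the Goldbach average: polynomial growth of `riemannZeta₁` and the Borel–Carathéodory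
inequality bound its logarithmic derivative by C(1+|t|)^η to the right of the critical line. A
Perron integral for ψ(N) - N, shifted to Re s = 1/2 + ε/2, then gives ψ(N) = N + O(N^{1/2+ε})
(`exists_abs_chebyshevSum_sub_le`). Since ∑_{n≤N} G(n) = ∑ Λ(m)ψ(N-m), replacing ψ by its main term
twice costs O(N^{3/2+ε}) (`abs_sum_range_goldbachG_sub_le`). -/

section SingularSeries

/-! ### The average of the singular series -/

/-- The local weight `1 / (p - 2)` of the singular series at the odd primes. -/
noncomputable def singularWeight (p : ℕ) : ℝ := if 2 < p then 1 / ((p : ℝ) - 2) else 0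

lemma singularWeight_nonneg (p : ℕ) : 0 ≤ singularWeight p := by
  unfold singularWeight
  split_ifs with h
  · have : (2 : ℝ) < p := by exact_mod_cast h
    exact div_nonneg zero_le_one (by linarith)
  · exact le_rfl

lemma singularWeight_le (p : ℕ) : singularWeight p ≤ 3 / p := by
  unfold singularWeight
  split_ifs with h
  · have : (3 : ℝ) ≤ p := by exact_mod_cast h
    rw [div_le_div_iff₀ (by linarith) (by linarith)]
    linarith
  · positivity

/-- The multiplicative function supported on squarefree numbers with value `singularWeight p`
at the primes, twisted by `d ^ (-a)`. -/
noncomputable def singularCoeff (a : ℝ) (d : ℕ) : ℝ :=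
  if Squarefree d then (∏ p ∈ d.primeFactors, singularWeight p) * (d : ℝ) ^ (-a) else 0

lemma singularCoeff_nonneg (a : ℝ) (d : ℕ) : 0 ≤ singularCoeff a d := by
  unfold singularCoeff
  split_ifs
  · exact mul_nonneg (Finset.prod_nonneg fun p _ => singularWeight_nonneg p) (by positivity)
  · exact le_rfl

lemma singularCoeff_zero (a : ℝ) : singularCoeff a 0 = 0 := by simp [singularCoeff]

lemma singularCoeff_one (a : ℝ) : singularCoeff a 1 = 1 := by simp [singularCoeff]

lemma singularCoeff_eq (a : ℝ) (d : ℕ) :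
    singularCoeff a d = singularCoeff 0 d * (d : ℝ) ^ (-a) := by
  unfold singularCoeff; split_ifs <;> simp

lemma singularCoeff_mul (a : ℝ) {m n : ℕ} (h : m.Coprime n) :
    singularCoeff a (m * n) = singularCoeff a m * singularCoeff a n := by
  unfold singularCoeff
  simp only [Nat.squarefree_mul h]
  by_cases hm : Squarefree m <;> by_cases hn : Squarefree n <;> simp only [hm, hn, and_true,
    and_self, if_true, if_false, mul_zero, zero_mul, and_false]
  rw [h.primeFactors_mul, Finset.prod_union h.disjoint_primeFactors, Nat.cast_mul,
    Real.mul_rpow (by positivity) (by positivity)]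
  ring

lemma singularCoeff_prime (a : ℝ) {p : ℕ} (hp : p.Prime) :
    singularCoeff a p = singularWeight p * (p : ℝ) ^ (-a) := by
  simp [singularCoeff, hp.prime.squarefree, hp.primeFactors]

lemma singularCoeff_prime_pow (a : ℝ) {p e : ℕ} (hp : p.Prime) (he : 2 ≤ e) :
    singularCoeff a (p ^ e) = 0 := by
  unfold singularCoeff
  rw [if_neg]
  intro h
  have := (Nat.squarefree_pow_iff hp.ne_one (by omega)).1 h
  omega

lemma tsum_singularCoeff_prime_pow (a : ℝ) {p : ℕ} (hp : p.Prime) :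
    ∑' e, singularCoeff a (p ^ e) = 1 + singularWeight p * (p : ℝ) ^ (-a) := by
  rw [tsum_eq_sum (s := Finset.range 2)]
  · simp [Finset.sum_range_succ, singularCoeff_one, singularCoeff_prime a hp]
  · intro e he
    exact singularCoeff_prime_pow a hp (not_lt.1 fun h => he (Finset.mem_range.2 h))

/-- `singularCoeff` as a multiplicative arithmetic function. -/
noncomputable def singularArith (a : ℝ) : ArithmeticFunction ℝ :=
  ⟨singularCoeff a, singularCoeff_zero a⟩

lemma singularArith_isMultiplicative (a : ℝ) : (singularArith a).IsMultiplicative :=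
  ⟨singularCoeff_one a, fun h => singularCoeff_mul a h⟩

/-- The factors (p-1)/(p-2) of J are 1 + 1/(p-2); expanding their product gives a divisor sum, which
can be averaged by exchanging summations. -/
lemma prod_primeFactors_one_add_singularWeight {n : ℕ} (hn : n ≠ 0) :
    ∏ p ∈ n.primeFactors, (1 + singularWeight p) = ∑ d ∈ n.divisors, singularCoeff 0 d := by
  have h1 : ∑ d ∈ n.divisors, singularCoeff 0 d
      = ∑ d ∈ n.divisors with Squarefree d, ∏ p ∈ d.primeFactors, singularWeight p := by
    rw [Finset.sum_filter]
    exact Finset.sum_congr rfl fun d _ => by simp [singularCoeff]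
  rw [h1, Nat.sum_divisors_filter_squarefree hn, Finset.prod_one_add]
  rw [Nat.factors_eq]
  refine Finset.sum_congr (by rfl) fun t ht => ?_
  have ht' : ∀ p ∈ t, p.Prime := fun p hp =>
    Nat.prime_of_mem_primeFactors (Finset.mem_powerset.1 ht hp)
  have : t.val.prod = ∏ p ∈ t, p := t.prod_val
  rw [this, Nat.primeFactors_prod ht']

/-- The weight is O(1/p), so its twist is summable over primes. Every squarefree d < n divides
`primorial n`, so a partial sum is at most a finite Euler product, itself at most the exponential of
the prime sum. -/
lemma summable_singularCoeff {a : ℝ} (ha : 0 < a) : Summable (singularCoeff a) := by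
  have hs : Summable fun p : ℕ => singularWeight p * (p : ℝ) ^ (-a) := by
    refine Summable.of_nonneg_of_le
      (fun p => mul_nonneg (singularWeight_nonneg p) (by positivity)) (fun p => ?_)
      ((Real.summable_nat_rpow (p := -(1 + a))).2 (by linarith) |>.mul_left 3)
    rcases Nat.eq_zero_or_pos p with rfl | hp
    · simp [singularWeight]
      positivity
    have hp' : (0 : ℝ) < p := by exact_mod_cast hp
    calc singularWeight p * (p : ℝ) ^ (-a) ≤ 3 / p * (p : ℝ) ^ (-a) := by
          gcongr; exact singularWeight_le p
      _ = 3 * (p : ℝ) ^ (-(1 + a)) := by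
          rw [neg_add, Real.rpow_add hp', Real.rpow_neg_one]; ring
  refine summable_of_sum_range_le (c := Real.exp (∑' p : ℕ, singularWeight p * (p : ℝ) ^ (-a)))
    (singularCoeff_nonneg a) fun n => ?_
  have hsq := squarefree_primorial n
  calc ∑ d ∈ Finset.range n, singularCoeff a d
      ≤ ∑ d ∈ (primorial n).divisors, singularCoeff a d := by
        rw [← Finset.sum_filter_ne_zero]
        refine Finset.sum_le_sum_of_subset_of_nonneg (fun d hd => ?_)
          fun d _ _ => singularCoeff_nonneg a d
        simp only [Finset.mem_filter, Finset.mem_range] at hd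
        have hd2 : Squarefree d := by
          by_contra h
          exact hd.2 (by simp [singularCoeff, h])
        exact Nat.mem_divisors.2
          ⟨hd2.dvd_primorial.trans (primorial_dvd_primorial hd.1.le), hsq.ne_zero⟩
    _ = ∏ p ∈ (primorial n).primeFactors, (1 + singularCoeff a p) :=
        ((singularArith_isMultiplicative a).prodPrimeFactors_one_add_of_squarefree hsq).symm
    _ ≤ ∏ p ∈ (primorial n).primeFactors, Real.exp (singularWeight p * (p : ℝ) ^ (-a)) := by
        refine Finset.prod_le_prod (fun p _ => by linarith [singularCoeff_nonneg a p])
          fun p hp => ?_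
        rw [singularCoeff_prime a (Nat.prime_of_mem_primeFactors hp), add_comm]
        exact Real.add_one_le_exp _
    _ = Real.exp (∑ p ∈ (primorial n).primeFactors, singularWeight p * (p : ℝ) ^ (-a)) :=
        (Real.exp_sum _ _).symm
    _ ≤ _ := Real.exp_le_exp.2 (hs.sum_le_tsum _ fun p _ =>
        mul_nonneg (singularWeight_nonneg p) (by positivity))

/-- The Euler factors cancel at each odd prime: 1 + 1/(p(p-2)) = (p-1)²/(p(p-2)) is the inverse of 1
- 1/(p-1)². At p = 2 the factor is 1, so only the leading 2 of the constant survives. -/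
lemma twinPrimeC2_mul_tsum : twinPrimeC2 * ∑' d, singularCoeff 1 d = 2 := by
  have hsum : Summable fun d => ‖singularCoeff 1 d‖ := (summable_singularCoeff one_pos).norm
  have h1 := (singularArith_isMultiplicative 1).eulerProduct_hasProd hsum
  change HasProd (fun p : Nat.Primes => ∑' e, singularCoeff 1 ((p : ℕ) ^ e))
    (∑' d, singularCoeff 1 d) at h1
  have h2 := multipliable_twinPrimeC2.hasProd
  have h3 : HasProd (Set.mulIndicator {p : ℕ | p.Prime} fun p : ℕ => ∑' e, singularCoeff 1 (p ^ e))
      (∑' d, singularCoeff 1 d) := hasProd_subtype_iff_mulIndicator.1 h1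
  have h4 : HasProd (Set.mulIndicator {p : ℕ | p.Prime ∧ 2 < p}
      fun p : ℕ => (1 - 1 / ((p : ℝ) - 1) ^ 2)) (∏' p : {p : ℕ // p.Prime ∧ 2 < p},
      (1 - 1 / ((p : ℝ) - 1) ^ 2)) := hasProd_subtype_iff_mulIndicator.1 h2
  have h5 := h4.mul h3
  have h6 : (fun p : ℕ => Set.mulIndicator {p : ℕ | p.Prime ∧ 2 < p}
      (fun p : ℕ => (1 - 1 / ((p : ℝ) - 1) ^ 2)) p *
      Set.mulIndicator {p : ℕ | p.Prime} (fun p : ℕ => ∑' e, singularCoeff 1 (p ^ e)) p)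
      = fun _ => 1 := by
    ext p
    by_cases hp : p.Prime
    · by_cases hp2 : 2 < p
      · have e1 : p ∈ {p : ℕ | p.Prime ∧ 2 < p} := ⟨hp, hp2⟩
        have e2 : p ∈ {p : ℕ | p.Prime} := hp
        rw [Set.mulIndicator_of_mem e1, Set.mulIndicator_of_mem e2,
          tsum_singularCoeff_prime_pow 1 hp, Real.rpow_neg_one, singularWeight, if_pos hp2]
        have : (2 : ℝ) < p := by exact_mod_cast hp2
        have n1 : (p : ℝ) - 2 ≠ 0 := by linarith
        have n2 : (p : ℝ) - 1 ≠ 0 := by linarith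
        have n3 : (p : ℝ) ≠ 0 := by linarith
        field_simp
        ring
      · have e1 : p ∉ {p : ℕ | p.Prime ∧ 2 < p} := fun h => hp2 h.2
        have e2 : p ∈ {p : ℕ | p.Prime} := hp
        rw [Set.mulIndicator_of_notMem e1, Set.mulIndicator_of_mem e2,
          tsum_singularCoeff_prime_pow 1 hp, singularWeight, if_neg hp2]
        simp
    · have e1 : p ∉ {p : ℕ | p.Prime ∧ 2 < p} := fun h => hp h.1
      have e2 : p ∉ {p : ℕ | p.Prime} := hp
      rw [Set.mulIndicator_of_notMem e1, Set.mulIndicator_of_notMem e2, one_mul]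
  rw [h6] at h5
  have h7 := h5.unique hasProd_one
  rw [twinPrimeC2, mul_assoc, h7, mul_one]

lemma hardyLittlewoodJ_two_mul {m : ℕ} (hm : m ≠ 0) :
    hardyLittlewoodJ (2 * m) = 2 * twinPrimeC2 * (m * ∑ d ∈ m.divisors, singularCoeff 0 d) := by
  rw [hardyLittlewoodJ, if_pos (even_two_mul m), ← prod_primeFactors_one_add_singularWeight hm]
  have : ∏ p ∈ (2 * m).primeFactors with 2 < p, ((p : ℝ) - 1) / ((p : ℝ) - 2)
      = ∏ p ∈ m.primeFactors, (1 + singularWeight p) := by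
    have e : ∀ p : ℕ, (if 2 < p then ((p : ℝ) - 1) / ((p : ℝ) - 2) else 1)
        = 1 + singularWeight p := by
      intro p
      unfold singularWeight
      split_ifs with h
      · have : (2 : ℝ) < p := by exact_mod_cast h
        have n1 : (p : ℝ) - 2 ≠ 0 := by linarith
        field_simp
        ring
      · simp
    rw [Finset.prod_filter, Finset.prod_congr rfl fun p _ => e p,
      Nat.primeFactors_mul two_ne_zero hm, Nat.prime_two.primeFactors]
    -- The prime 2 has weight 0, so its presence or absence among the factors of m is immaterial.
    by_cases h2 : 2 ∈ m.primeFactors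
    · rw [Finset.union_eq_right.2 (by simpa using h2)]
    · rw [Finset.prod_union (by simpa using h2)]
      simp [singularWeight]
  rw [this]
  push_cast
  ring

lemma sum_Icc_mul_sum_divisors (f : ℕ → ℝ) (M : ℕ) :
    ∑ m ∈ Finset.Icc 1 M, (m : ℝ) * ∑ d ∈ m.divisors, f d
      = ∑ d ∈ Finset.Icc 1 M, f d * (d * ∑ k ∈ Finset.Icc 1 (M / d), (k : ℝ)) := by
  simp_rw [Finset.mul_sum]
  rw [Finset.sum_sigma', Finset.sum_sigma']
  refine Finset.sum_bij' (fun x _ => ⟨x.2, x.1 / x.2⟩) (fun y _ => ⟨y.1 * y.2, y.1⟩) ?_ ?_ ?_ ?_ ?_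
  · rintro ⟨m, d⟩ h
    simp only [Finset.mem_sigma, Finset.mem_Icc, Nat.mem_divisors] at h ⊢
    have hd := Nat.pos_of_dvd_of_pos h.2.1 (by omega)
    have hle := Nat.le_of_dvd (by omega) h.2.1
    exact ⟨⟨hd, by omega⟩, Nat.div_pos hle hd, Nat.div_le_div_right h.1.2⟩
  · rintro ⟨d, k⟩ h
    simp only [Finset.mem_sigma, Finset.mem_Icc, Nat.mem_divisors] at h ⊢
    have : k * d ≤ M := (Nat.le_div_iff_mul_le (by omega)).1 h.2.2
    have h2 : 0 < d * k := Nat.mul_pos (by omega) (by omega)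
    exact ⟨⟨h2, by linarith⟩, dvd_mul_right _ _, h2.ne'⟩
  · rintro ⟨m, d⟩ h
    simp only [Finset.mem_sigma, Finset.mem_Icc, Nat.mem_divisors] at h ⊢
    rw [Nat.mul_div_cancel' h.2.1]
  · rintro ⟨d, k⟩ h
    simp only [Finset.mem_sigma, Finset.mem_Icc] at h ⊢
    rw [Nat.mul_div_cancel_left _ (by omega)]
  · rintro ⟨m, d⟩ h
    simp only [Finset.mem_sigma, Finset.mem_Icc, Nat.mem_divisors] at h ⊢
    have : (m : ℝ) = d * ((m / d : ℕ) : ℝ) := by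
      rw [← Nat.cast_mul, Nat.mul_div_cancel' h.2.1]
    rw [this]
    ring

lemma sum_Icc_one_cast (k : ℕ) : ∑ i ∈ Finset.Icc 1 k, (i : ℝ) = k * (k + 1) / 2 := by
  induction k with
  | zero => simp
  | succ k ih => rw [Finset.sum_Icc_succ_top (by omega), ih]; push_cast; ring

/-- The natural error O(M) for d ≤ M cannot be summed over all d, as the untwisted coefficients are
not summable. With y = M/d, the weaker bound d·y^{3/2} covers both y ≥ 1 and y < 1, where the inner
sum is empty, and leaves a factor d^{-1/2} for convergence. -/
lemma abs_mul_sum_Icc_div_sub_le {d M : ℕ} (hd : 1 ≤ d) :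
    |d * ∑ k ∈ Finset.Icc 1 (M / d), (k : ℝ) - (M : ℝ) ^ 2 / 2 * (d : ℝ) ^ (-1 : ℝ)|
      ≤ (M : ℝ) ^ (3 / 2 : ℝ) * (d : ℝ) ^ (-(1 / 2) : ℝ) := by
  have hd0 : (0 : ℝ) < d := by exact_mod_cast hd
  have hM0 : (0 : ℝ) ≤ M := Nat.cast_nonneg M
  have key : (M : ℝ) ^ (3 / 2 : ℝ) * (d : ℝ) ^ (-(1 / 2) : ℝ) = M * ((M / d : ℝ)) ^ (1 / 2 : ℝ) := by
    rw [Real.div_rpow hM0 hd0.le, Real.rpow_neg hd0.le, show (3 / 2 : ℝ) = 1 + 1 / 2 by norm_num,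
      Real.rpow_add' hM0 (by norm_num), Real.rpow_one]
    ring
  rw [key, sum_Icc_one_cast, Real.rpow_neg_one]
  set q : ℕ := M / d with hq
  have h1 : (d : ℝ) * q ≤ M := by exact_mod_cast Nat.mul_div_le M d
  have h2 : (M : ℝ) < d * (q + 1) := by
    have := Nat.lt_mul_of_div_lt (Nat.lt_succ_self q) hd
    rw [Nat.succ_eq_add_one, mul_comm] at this
    exact_mod_cast this
  have h3 : (0 : ℝ) ≤ q := Nat.cast_nonneg q
  obtain ⟨y, hy⟩ : ∃ y : ℝ, y = M / d := ⟨_, rfl⟩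
  have hMy : (M : ℝ) = d * y := by rw [hy]; field_simp
  rw [← hy]
  have hy0 : 0 ≤ y := by rw [hy]; positivity
  have h1' : (q : ℝ) ≤ y := by rw [hMy] at h1; exact le_of_mul_le_mul_left h1 hd0
  have h2' : y < q + 1 := by rw [hMy] at h2; exact lt_of_mul_lt_mul_left h2 hd0.le
  have e : (d : ℝ) * (q * (q + 1) / 2) - (M : ℝ) ^ 2 / 2 * (d : ℝ)⁻¹
      = d * ((q * (q + 1) - y ^ 2) / 2) := by
    rw [hMy]; field_simp
  rw [e, abs_mul, abs_of_pos hd0, hMy, mul_assoc]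
  refine mul_le_mul_of_nonneg_left ?_ hd0.le
  rcases le_or_gt 1 y with h | h
  · have : 1 ≤ y ^ (1 / 2 : ℝ) := Real.one_le_rpow h (by norm_num)
    calc |((q : ℝ) * (q + 1) - y ^ 2) / 2| ≤ y := by
          rw [abs_le]; constructor <;> nlinarith
      _ ≤ y * y ^ (1 / 2 : ℝ) := le_mul_of_one_le_right hy0 this
  · have hq0 : (q : ℝ) = 0 := by
      have : (q : ℝ) < 1 := by linarith
      have : q < 1 := by exact_mod_cast this
      exact_mod_cast Nat.lt_one_iff.1 this
    have : y ≤ y ^ (1 / 2 : ℝ) := by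
      conv_lhs => rw [← Real.rpow_one y]
      rcases hy0.eq_or_lt with h0 | h0
      · rw [← h0]; simp
      · exact Real.rpow_le_rpow_of_exponent_ge h0 h.le (by norm_num)
    rw [hq0, abs_le]
    constructor <;> nlinarith

lemma abs_sum_mul_sum_divisors_sub_le (M : ℕ) :
    |∑ m ∈ Finset.Icc 1 M, (m : ℝ) * ∑ d ∈ m.divisors, singularCoeff 0 d
        - (M : ℝ) ^ 2 / 2 * ∑' d, singularCoeff 1 d|
      ≤ (M : ℝ) ^ (3 / 2 : ℝ) * ∑' d, singularCoeff (1 / 2) d := by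
  have s1 := summable_singularCoeff one_pos
  have s2 := summable_singularCoeff (a := 1 / 2) (by norm_num)
  have h0 : ∀ d ∉ Finset.Icc 1 M,
      singularCoeff 0 d * (d * ∑ k ∈ Finset.Icc 1 (M / d), (k : ℝ)) = 0 := by
    intro d hd
    rcases Nat.eq_zero_or_pos d with rfl | h
    · simp
    · rw [Nat.div_eq_of_lt (by simp at hd; omega)]
      simp
  rw [sum_Icc_mul_sum_divisors, ← tsum_eq_sum (L := SummationFilter.unconditional ℕ) h0, ← tsum_mul_left,
    ← tsum_mul_left,
    ← (summable_of_ne_finset_zero h0).tsum_sub (s1.mul_left _), ← Real.norm_eq_abs]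
  refine tsum_of_norm_bounded (s2.mul_left _).hasSum fun d => ?_
  rcases Nat.eq_zero_or_pos d with rfl | h
  · simp [singularCoeff_zero]
  rw [singularCoeff_eq 1, singularCoeff_eq (1 / 2), Real.norm_eq_abs]
  calc _ = singularCoeff 0 d * |d * ∑ k ∈ Finset.Icc 1 (M / d), (k : ℝ)
        - (M : ℝ) ^ 2 / 2 * (d : ℝ) ^ (-1 : ℝ)| := by
        rw [← abs_of_nonneg (singularCoeff_nonneg 0 d), ← abs_mul, abs_of_nonneg
          (singularCoeff_nonneg 0 d)]
        congr 1; ring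
    _ ≤ singularCoeff 0 d * ((M : ℝ) ^ (3 / 2 : ℝ) * (d : ℝ) ^ (-(1 / 2) : ℝ)) :=
        mul_le_mul_of_nonneg_left (abs_mul_sum_Icc_div_sub_le h) (singularCoeff_nonneg 0 d)
    _ = _ := by ring

lemma sum_Icc_hardyLittlewoodJ (N : ℕ) :
    ∑ n ∈ Finset.Icc 1 N, hardyLittlewoodJ n
      = 2 * twinPrimeC2 *
        ∑ m ∈ Finset.Icc 1 (N / 2), (m : ℝ) * ∑ d ∈ m.divisors, singularCoeff 0 d := by
  have h1 : ∑ n ∈ Finset.Icc 1 N, hardyLittlewoodJ n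
      = ∑ n ∈ Finset.Icc 1 N with Even n, hardyLittlewoodJ n := by
    rw [Finset.sum_filter]
    refine Finset.sum_congr rfl fun n _ => ?_
    split_ifs with h
    · rfl
    · simp [hardyLittlewoodJ, h]
  rw [h1, Finset.mul_sum]
  refine Finset.sum_bij' (fun n _ => n / 2) (fun m _ => 2 * m) ?_ ?_ ?_ ?_ ?_
  · intro n hn
    simp only [Finset.mem_filter, Finset.mem_Icc] at hn ⊢
    obtain ⟨⟨h, h'⟩, k, rfl⟩ := hn
    omega
  · intro n hn
    simp only [Finset.mem_filter, Finset.mem_Icc] at hn ⊢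
    exact ⟨by omega, even_two_mul n⟩
  · intro n hn
    simp only [Finset.mem_filter, Finset.mem_Icc] at hn ⊢
    exact Nat.two_mul_div_two_of_even hn.2
  · intro n hn
    omega
  · intro n hn
    simp only [Finset.mem_filter, Finset.mem_Icc] at hn ⊢
    conv_lhs => rw [← Nat.two_mul_div_two_of_even hn.2]
    obtain ⟨⟨h, h'⟩, k, rfl⟩ := hn
    exact hardyLittlewoodJ_two_mul (by omega)

/-- The average order of the singular series. -/
theorem exists_abs_sum_hardyLittlewoodJ_sub_le :
    ∃ C : ℝ, ∀ N : ℕ, |∑ n ∈ Finset.Icc 1 N, hardyLittlewoodJ n - (N : ℝ) ^ 2 / 2|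
      ≤ C * (N : ℝ) ^ (3 / 2 : ℝ) := by
  set S := ∑' d, singularCoeff (1 / 2) d
  refine ⟨|2 * twinPrimeC2| * S + 1, fun N => ?_⟩
  have hS : 0 ≤ S := tsum_nonneg fun d => singularCoeff_nonneg _ d
  have h := abs_sum_mul_sum_divisors_sub_le (N / 2)
  rw [sum_Icc_hardyLittlewoodJ]
  set A := ∑ m ∈ Finset.Icc 1 (N / 2), (m : ℝ) * ∑ d ∈ m.divisors, singularCoeff 0 d
  set M := N / 2 with hM
  have hMN : (M : ℝ) ≤ N := by exact_mod_cast Nat.div_le_self N 2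
  have h1 : 2 * (M : ℝ) ≤ N := by exact_mod_cast (by omega : 2 * M ≤ N)
  have h2 : (N : ℝ) ≤ 2 * M + 1 := by exact_mod_cast (by omega : N ≤ 2 * M + 1)
  have hM0 : (0 : ℝ) ≤ M := Nat.cast_nonneg M
  -- The main term is 2M² since C₂ times the singular sum is 2; for odd N it differs from N²/2 by
  -- O(N).
  have e : 2 * twinPrimeC2 * A - (N : ℝ) ^ 2 / 2
      = 2 * twinPrimeC2 * (A - (M : ℝ) ^ 2 / 2 * ∑' d, singularCoeff 1 d)
        + (2 * (M : ℝ) ^ 2 - (N : ℝ) ^ 2 / 2) := by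
    linear_combination ((M : ℝ) ^ 2) * twinPrimeC2_mul_tsum
  rw [e]
  have hN : (N : ℝ) ≤ (N : ℝ) ^ (3 / 2 : ℝ) := by
    rcases Nat.eq_zero_or_pos N with h0 | h0
    · rw [h0]; simp
    · conv_lhs => rw [← Real.rpow_one (N : ℝ)]
      exact Real.rpow_le_rpow_of_exponent_le (by exact_mod_cast h0) (by norm_num)
  calc _ ≤ |2 * twinPrimeC2| * |A - (M : ℝ) ^ 2 / 2 * ∑' d, singularCoeff 1 d|
        + |2 * (M : ℝ) ^ 2 - (N : ℝ) ^ 2 / 2| := by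
        rw [← abs_mul]; exact abs_add_le _ _
    _ ≤ |2 * twinPrimeC2| * ((N : ℝ) ^ (3 / 2 : ℝ) * S) + N := by
        refine add_le_add (mul_le_mul_of_nonneg_left (h.trans ?_) (abs_nonneg _)) ?_
        · gcongr
        · have : (N : ℝ) * (N - 2 * M) ≤ N * 1 :=
            mul_le_mul_of_nonneg_left (by linarith) (by linarith)
          have : (M : ℝ) * (N - 2 * M) ≤ M * 1 :=
            mul_le_mul_of_nonneg_left (by linarith) (by linarith)
          rw [abs_le]; constructor <;> nlinarith
    _ ≤ _ := by linarith

end SingularSeries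

/-! ### Exponential series and their behaviour at 0 and infinity -/

section ExpSeries

open Real

/-- The Dirichlet series `∑ aₙ e^{-nr}`. -/
noncomputable def expSeries (a : ℕ → ℝ) (r : ℝ) : ℝ := ∑' n : ℕ, a n * exp (-n * r)

lemma exp_neg_mul_eq_pow (n : ℕ) (r : ℝ) : exp (-n * r) = exp (-r) ^ n := by
  rw [← exp_nat_mul]; ring_nf

lemma exp_neg_lt_one {r : ℝ} (hr : 0 < r) : exp (-r) < 1 := by
  rw [exp_lt_one_iff]; linarith

lemma summable_rpow_mul_exp {c r : ℝ} (hr : 0 < r) :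
    Summable fun n : ℕ => (n : ℝ) ^ c * exp (-n * r) := by
  have h1 : Summable fun n : ℕ => ((n : ℝ) ^ ⌈c⌉₊ : ℝ) * exp (-r) ^ n :=
    summable_pow_mul_geometric_of_norm_lt_one _ (by
      rw [norm_of_nonneg (exp_pos _).le]; exact exp_neg_lt_one hr)
  refine h1.of_norm_bounded_eventually_nat ?_
  filter_upwards [eventually_ge_atTop 1] with n hn
  rw [norm_of_nonneg (by positivity), exp_neg_mul_eq_pow, ← rpow_natCast (n : ℝ) ⌈c⌉₊]
  have : (1 : ℝ) ≤ n := by exact_mod_cast hn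
  gcongr
  exact Nat.le_ceil c

lemma rpow_le_mul_exp_half {c x : ℝ} (hc : 0 < c) (hx : 0 ≤ x) :
    x ^ c ≤ (2 * c) ^ c * exp (x / 2) := by
  have h1 : x / (2 * c) ≤ exp (x / (2 * c)) := (by linarith [add_one_le_exp (x / (2 * c))])
  have h2 : (x / (2 * c)) ^ c ≤ exp (x / 2) := by
    calc (x / (2 * c)) ^ c ≤ exp (x / (2 * c)) ^ c := rpow_le_rpow (by positivity) h1 hc.le
      _ = exp (x / 2) := by rw [← exp_mul]; congr 1; field_simp
  calc x ^ c = (2 * c) ^ c * (x / (2 * c)) ^ c := by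
        rw [← mul_rpow (by positivity) (by positivity)]; congr 1; field_simp
    _ ≤ _ := by gcongr

lemma half_le_one_sub_exp_neg {r : ℝ} (hr : 0 < r) (hr1 : r ≤ 1) : r / 2 ≤ 1 - exp (-r) := by
  have h1 : exp (-r) ≤ 1 / (1 + r) := by
    rw [exp_neg, inv_eq_one_div]
    exact one_div_le_one_div_of_le (by linarith) (by linarith [add_one_le_exp r])
  have h2 : 1 / (1 + r) ≤ 1 - r / 2 := by
    rw [div_le_iff₀ (by linarith)]; nlinarith
  linarith

/-- Half of the exponential decay absorbs n^c; the other half leaves a geometric series of size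
O(1/r). -/
lemma expSeries_rpow_le {c r : ℝ} (hc : 0 < c) (hr : 0 < r) (hr1 : r ≤ 1) :
    expSeries (fun n => (n : ℝ) ^ c) r ≤ 4 * (2 * c) ^ c * r ^ (-c - 1) := by
  have hq : exp (-(r / 2)) < 1 := exp_neg_lt_one (by positivity)
  have hg := hasSum_geometric_of_lt_one (exp_pos (-(r / 2))).le hq
  have hb : ∀ n : ℕ, (n : ℝ) ^ c * exp (-n * r) ≤ r ^ (-c) * (2 * c) ^ c * exp (-(r / 2)) ^ n := by
    intro n
    have h1 := rpow_le_mul_exp_half hc (x := n * r) (by positivity)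
    rw [mul_rpow (by positivity) hr.le] at h1
    have h2 : exp (-(n : ℝ) * r) = exp (-(r / 2)) ^ n * exp (-(n * r / 2)) := by
      rw [← exp_nat_mul, ← exp_add]; ring_nf
    have h3 : exp (n * r / 2) * exp (-(n * r / 2)) = 1 := by rw [← exp_add]; simp
    have h4 : r ^ c * r ^ (-c) = 1 := by rw [← rpow_add hr]; simp
    calc (n : ℝ) ^ c * exp (-n * r)
        = ((n : ℝ) ^ c * r ^ c) * r ^ (-c) * (exp (-(r / 2)) ^ n * exp (-(n * r / 2))) := by
          rw [h2, mul_assoc ((n : ℝ) ^ c), h4, mul_one]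
      _ ≤ ((2 * c) ^ c * exp (n * r / 2)) * r ^ (-c)
          * (exp (-(r / 2)) ^ n * exp (-(n * r / 2))) := by gcongr
      _ = r ^ (-c) * (2 * c) ^ c * exp (-(r / 2)) ^ n
          * (exp (n * r / 2) * exp (-(n * r / 2))) := by ring
      _ = _ := by rw [h3, mul_one]
  have h5 := (summable_rpow_mul_exp (c := c) hr).hasSum
  calc expSeries (fun n => (n : ℝ) ^ c) r
      ≤ r ^ (-c) * (2 * c) ^ c * (1 - exp (-(r / 2)))⁻¹ := hasSum_le hb h5 (hg.mul_left _)
    _ ≤ r ^ (-c) * (2 * c) ^ c * (4 * r⁻¹) := by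
        gcongr
        rw [inv_le_comm₀ (by linarith) (by positivity), mul_inv, inv_inv]
        have := half_le_one_sub_exp_neg (r := r / 2) (by positivity) (by linarith)
        linarith
    _ = _ := by rw [rpow_sub hr, rpow_one]; ring

lemma summable_expSeries_of_abs_le {a : ℕ → ℝ} {C c r : ℝ} (ha : ∀ n, |a n| ≤ C * (n : ℝ) ^ c)
    (hr : 0 < r) : Summable fun n : ℕ => a n * exp (-n * r) := by
  refine ((summable_rpow_mul_exp (c := c) hr).mul_left C).of_norm_bounded fun n => ?_
  rw [norm_mul, norm_of_nonneg (exp_pos _).le, ← mul_assoc]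
  exact mul_le_mul_of_nonneg_right (ha n) (exp_pos _).le

/-- Abel summation: a bound for the partial sums bounds the exponential series near `0`. -/
lemma abs_expSeries_le_of_partialSums {a : ℕ → ℝ} {C c : ℝ} (ha0 : a 0 = 0) (hC : 0 ≤ C)
    (hc : 0 < c) (ha : ∀ N, |∑ n ∈ Finset.range (N + 1), a n| ≤ C * (N : ℝ) ^ c) {r : ℝ}
    (hr : 0 < r) (hr1 : r ≤ 1) :
    |expSeries a r| ≤ C * (4 * (2 * c) ^ c) * r ^ (-c) := by
  set A : ℕ → ℝ := fun N => ∑ n ∈ Finset.range (N + 1), a n with hA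
  have hs := summable_expSeries_of_abs_le ha hr
  have hA0 : A 0 = 0 := by simp [hA, ha0]
  have h1 : HasSum (fun n : ℕ => A (n + 1) * exp (-(n + 1 : ℕ) * r)) (expSeries A r) := by
    have := (hasSum_nat_add_iff' 1).2 hs.hasSum
    simpa [hA0, ha0, expSeries] using this
  have h2 : HasSum (fun n : ℕ => exp (-r) * (A n * exp (-n * r))) (exp (-r) * expSeries A r) :=
    hs.hasSum.mul_left _
  -- Subtracting the shifted series of A recovers a; the resulting factor 1 - e^{-r} ≤ r gains back
  -- one power of r.
  have h3 : HasSum (fun n : ℕ => a (n + 1) * exp (-(n + 1 : ℕ) * r))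
      (expSeries A r - exp (-r) * expSeries A r) := by
    refine (h1.sub h2).congr_fun fun n => ?_
    have : A (n + 1) = A n + a (n + 1) := Finset.sum_range_succ _ _
    have e : exp (-((n + 1 : ℕ) : ℝ) * r) = exp (-r) * exp (-n * r) := by
      rw [← exp_add]; push_cast; ring_nf
    rw [this, e]; ring
  have h4 : HasSum (fun n : ℕ => a n * exp (-n * r))
      (expSeries A r - exp (-r) * expSeries A r) := by
    rw [← hasSum_nat_add_iff' 1]
    simpa [ha0] using h3
  have h5 : expSeries a r = (1 - exp (-r)) * expSeries A r := by
    rw [expSeries, h4.tsum_eq]; ring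
  have h6 : |expSeries A r| ≤ C * expSeries (fun n => (n : ℝ) ^ c) r := by
    rw [← norm_eq_abs]
    refine tsum_of_norm_bounded ((summable_rpow_mul_exp hr).hasSum.mul_left C) fun n => ?_
    rw [norm_mul, norm_of_nonneg (exp_pos _).le, ← mul_assoc]
    exact mul_le_mul_of_nonneg_right (ha n) (exp_pos _).le
  have h7 : |1 - exp (-r)| ≤ r := by
    rw [abs_of_nonneg (by linarith [exp_neg_lt_one hr])]
    linarith [add_one_le_exp (-r)]
  calc |expSeries a r| ≤ r * (C * (4 * (2 * c) ^ c * r ^ (-c - 1))) := by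
        rw [h5, abs_mul]
        gcongr
        exact h6.trans (by gcongr; exact expSeries_rpow_le hc hr hr1)
    _ = _ := by rw [rpow_sub hr, rpow_one]; field_simp

lemma continuousOn_expSeries {a : ℕ → ℝ} {C c : ℝ} (ha : ∀ n, |a n| ≤ C * (n : ℝ) ^ c) :
    ContinuousOn (expSeries a) (Set.Ioi 0) := by
  intro r hr
  have hr' : 0 < r / 2 := half_pos hr
  have h : ContinuousOn (expSeries a) (Set.Ioi (r / 2)) := by
    refine continuousOn_tsum (u := fun n : ℕ => |a n| * exp (-n * (r / 2)))
      (fun n => by fun_prop) ?_ fun n x hx => ?_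
    · exact summable_expSeries_of_abs_le (a := fun n => |a n|) (by simpa using ha) hr'
    · rw [norm_mul, norm_of_nonneg (exp_pos _).le, norm_eq_abs]
      have hx' : r / 2 < x := hx
      have : -(n : ℝ) * x ≤ -n * (r / 2) := by
        have := mul_le_mul_of_nonneg_left hx'.le (Nat.cast_nonneg (α := ℝ) n)
        linarith
      gcongr
  exact (h.continuousAt (Ioi_mem_nhds (by simpa using hr))).continuousWithinAt

lemma expSeries_isBigO_exp {a : ℕ → ℝ} {C c : ℝ} (ha0 : a 0 = 0)
    (ha : ∀ n, |a n| ≤ C * (n : ℝ) ^ c) :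
    expSeries a =O[atTop] fun r => exp (-(1 / 2) * r) := by
  refine IsBigO.of_bound (expSeries (fun n => |a n|) (1 / 2)) ?_
  filter_upwards [eventually_ge_atTop 1] with r hr
  have hs := summable_expSeries_of_abs_le (a := fun n => |a n|) (r := 1 / 2)
    (by simpa using ha) (by norm_num)
  refine tsum_of_norm_bounded (hs.hasSum.mul_right _) fun n => ?_
  rcases Nat.eq_zero_or_pos n with rfl | hn
  · simp [ha0]
  have hn1 : (1 : ℝ) ≤ n := by exact_mod_cast hn
  rw [norm_mul, norm_of_nonneg (exp_pos _).le, norm_of_nonneg (exp_pos _).le, norm_eq_abs,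
    mul_assoc, ← exp_add]
  gcongr
  -- From (n-1)(r-1) ≥ 0 and n + r ≥ 2 follows nr ≥ (n + r)/2; the term n = 0, which would not
  -- decay, vanishes by `ha0`.
  nlinarith [mul_nonneg (sub_nonneg.2 hn1) (sub_nonneg.2 hr)]

end ExpSeries

/-! ### From the Goldbach average to the Riemann Hypothesis -/

section Converse

open Real ArithmeticFunction

lemma vonMangoldt_le_self (n : ℕ) : vonMangoldt n ≤ n :=
  vonMangoldt_le_log.trans (log_le_self (Nat.cast_nonneg n))

/-- The coefficients `Λ(n) - 1` for `n ≥ 1`, and `0` for `n = 0`. -/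
noncomputable def mangoldtSubOne (n : ℕ) : ℝ := if n = 0 then 0 else vonMangoldt n - 1

lemma abs_mangoldtSubOne_le (n : ℕ) : |mangoldtSubOne n| ≤ 1 * (n : ℝ) ^ (1 : ℝ) := by
  unfold mangoldtSubOne
  split_ifs with h
  · simp [h]
  · have h1 := vonMangoldt_le_self n
    have h2 : 0 ≤ vonMangoldt n := vonMangoldt_nonneg
    have h3 : (1 : ℝ) ≤ n := by exact_mod_cast Nat.one_le_iff_ne_zero.2 h
    rw [rpow_one, one_mul, abs_le]
    constructor <;> linarith

lemma summable_vonMangoldt_exp {r : ℝ} (hr : 0 < r) :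
    Summable fun n : ℕ => vonMangoldt n * exp (-n * r) :=
  summable_expSeries_of_abs_le (a := fun n => vonMangoldt n) (C := 1) (c := 1) (fun n => by
    rw [rpow_one, one_mul, abs_of_nonneg vonMangoldt_nonneg]; exact vonMangoldt_le_self n) hr

lemma hasSum_exp_tail {r : ℝ} (hr : 0 < r) :
    HasSum (fun n : ℕ => (if n = 0 then 0 else 1) * exp (-n * r))
      (exp (-r) / (1 - exp (-r))) := by
  have h1 : HasSum (fun n : ℕ => exp (-r) * exp (-r) ^ n) (exp (-r) * (1 - exp (-r))⁻¹) :=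
    (hasSum_geometric_of_lt_one (exp_pos _).le (exp_neg_lt_one hr)).mul_left _
  rw [← hasSum_nat_add_iff' 1]
  simp only [exp_neg_mul_eq_pow]
  simpa [pow_succ', div_eq_mul_inv] using h1

lemma expSeries_mangoldtSubOne {r : ℝ} (hr : 0 < r) :
    expSeries mangoldtSubOne r
      = expSeries (fun n => vonMangoldt n) r - exp (-r) / (1 - exp (-r)) := by
  refine HasSum.tsum_eq (((summable_vonMangoldt_exp hr).hasSum.sub (hasSum_exp_tail hr)).congr_fun
    fun n => ?_)
  unfold mangoldtSubOne
  split_ifs with h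
  · simp [h]
  · ring

lemma expSeries_goldbachG {r : ℝ} (hr : 0 < r) :
    Summable (fun n : ℕ => goldbachG n * exp (-n * r)) ∧
    expSeries goldbachG r = expSeries (fun n => vonMangoldt n) r ^ 2 := by
  have hs := summable_vonMangoldt_exp hr
  have h1 : ∀ n : ℕ, ∑ kl ∈ Finset.HasAntidiagonal.antidiagonal n,
      (vonMangoldt kl.1 * exp (-(kl.1 : ℕ) * r)) * (vonMangoldt kl.2 * exp (-(kl.2 : ℕ) * r))
      = goldbachG n * exp (-n * r) := by
    intro n
    rw [goldbachG, Finset.sum_mul]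
    refine Finset.sum_congr rfl fun kl hkl => ?_
    have : (n : ℝ) = kl.1 + kl.2 := by
      exact_mod_cast (Finset.HasAntidiagonal.mem_antidiagonal.1 hkl).symm
    have e : exp (-(n : ℝ) * r) = exp (-(kl.1 : ℕ) * r) * exp (-(kl.2 : ℕ) * r) := by
      rw [← exp_add, this]; ring_nf
    rw [e]; ring
  constructor
  · have := summable_norm_sum_mul_antidiagonal_of_summable_norm hs.norm hs.norm
    exact this.of_norm.congr fun n => h1 n
  · rw [sq, expSeries, expSeries, tsum_mul_tsum_eq_tsum_sum_antidiagonal_of_summable_norm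
      hs.norm hs.norm]
    exact tsum_congr fun n => (h1 n).symm

lemma hasSum_nat_mul_exp {r : ℝ} (hr : 0 < r) : HasSum (fun n : ℕ => (n : ℝ) * exp (-n * r))
    (exp (-r) / (1 - exp (-r)) ^ 2) := by
  simp only [exp_neg_mul_eq_pow]
  exact hasSum_coe_mul_geometric_of_norm_lt_one (by
    rw [norm_of_nonneg (exp_pos _).le]; exact exp_neg_lt_one hr)

/-- A bound for the average order of `G` gives a bound for the exponential series of `Λ - 1`. -/
lemma expSeries_mangoldtSubOne_isBigO {c C : ℝ} (hc : 1 ≤ c) (hC : 0 ≤ C)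
    (h : ∀ N : ℕ, |∑ n ∈ Finset.range (N + 1), (goldbachG n - n)| ≤ C * (N : ℝ) ^ c) :
    expSeries mangoldtSubOne =O[nhdsWithin 0 (Set.Ioi 0)] fun r => r ^ (-(c - 1)) := by
  set K := C * (4 * (2 * c) ^ c)
  refine IsBigO.of_bound (2 * (K + 2)) ?_
  filter_upwards [Ioo_mem_nhdsGT (zero_lt_one (α := ℝ))] with r hr
  have hr0 : 0 < r := hr.1
  have h0 : goldbachG 0 - ((0 : ℕ) : ℝ) = 0 := by simp [goldbachG]
  have h1 := abs_expSeries_le_of_partialSums (a := fun n => goldbachG n - n) h0 hC (by linarith) h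
    hr0 hr.2.le
  obtain ⟨hs, hG⟩ := expSeries_goldbachG hr0
  set F := expSeries (fun n => vonMangoldt n) r with hF
  set x := exp (-r) with hx
  have hx1 : x < 1 := exp_neg_lt_one hr0
  have hx0 : 0 < x := exp_pos _
  have h2 : expSeries (fun n => goldbachG n - n) r = F ^ 2 - x / (1 - x) ^ 2 := by
    rw [← hG]
    exact HasSum.tsum_eq ((hs.hasSum.sub (hasSum_nat_mul_exp hr0)).congr_fun fun n => by
      rw [sub_mul])
  rw [h2] at h1
  have hF0 : 0 ≤ F := tsum_nonneg fun n => mul_nonneg vonMangoldt_nonneg (exp_pos _).le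
  set y := x / (1 - x) with hy
  have hy0 : 0 < y := div_pos hx0 (by linarith)
  -- The series ∑ n e^{-nr} is y² up to the term y = O(1/r), which is admissible because c ≥ 1.
  have hyy : x / (1 - x) ^ 2 = y ^ 2 + y := by
    rw [hy]; have : 1 - x ≠ 0 := by linarith
    field_simp; ring
  have hyr : 1 / (2 * r) ≤ y := by
    have e1 := abs_exp_sub_one_le (x := r) (by rw [abs_of_pos hr0]; exact hr.2.le)
    rw [abs_of_pos hr0] at e1
    have e2 := (abs_le.1 e1).2
    have e3 : x * exp r = 1 := by rw [hx, ← exp_add]; simp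
    rw [hy, div_le_div_iff₀ (by linarith) (by linarith)]
    nlinarith
  have hyr2 : y ≤ 2 / r := by
    have := half_le_one_sub_exp_neg hr0 hr.2.le
    rw [hy, div_le_div_iff₀ (by linarith) hr0]
    nlinarith
  have hrc : r⁻¹ ≤ r ^ (-c) := by
    rw [← rpow_neg_one]
    exact rpow_le_rpow_of_exponent_ge hr0 hr.2.le (by linarith)
  have h3 : |F ^ 2 - y ^ 2| ≤ (K + 2) * r ^ (-c) := by
    calc |F ^ 2 - y ^ 2| = |(F ^ 2 - x / (1 - x) ^ 2) + y| := by rw [hyy]; congr 1; ring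
      _ ≤ K * r ^ (-c) + 2 / r := (abs_add_le _ _).trans
          (add_le_add h1 (by rw [abs_of_pos hy0]; exact hyr2))
      _ ≤ _ := by rw [div_eq_mul_inv]; linarith
  -- Positivity of Λ enters here: F ≥ 0 gives F + y ≥ 1/(2r), so the square root of F² is taken
  -- without loss.
  have h4 : |F - y| * (1 / (2 * r)) ≤ (K + 2) * r ^ (-c) := by
    calc |F - y| * (1 / (2 * r)) ≤ |F - y| * (F + y) := by gcongr; linarith
      _ = |F ^ 2 - y ^ 2| := by
          rw [show F ^ 2 - y ^ 2 = (F - y) * (F + y) by ring, abs_mul,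
            abs_of_nonneg (by linarith : 0 ≤ F + y)]
      _ ≤ _ := h3
  rw [expSeries_mangoldtSubOne hr0, norm_eq_abs, norm_of_nonneg (by positivity), neg_sub,
    show 1 - c = -c + 1 by ring, rpow_add hr0, rpow_one]
  change |F - y| ≤ _
  calc |F - y| = |F - y| * (1 / (2 * r)) * (2 * r) := by field_simp
    _ ≤ (K + 2) * r ^ (-c) * (2 * r) := by gcongr
    _ = _ := by ring

/-- Termwise, the Mellin transform of e^{-nr} is Γ(s)n^{-s}, so the Dirichlet series of Λ - 1
appears. -/
lemma mellin_mangoldtSubOne {s : ℂ} (hs : 1 < s.re) :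
    mellin (fun r => (expSeries mangoldtSubOne r : ℂ)) s
      = Complex.Gamma s * (-deriv riemannZeta s / riemannZeta s - riemannZeta s) := by
  have hΛ := LSeriesSummable_vonMangoldt hs
  have h1 : LSeriesSummable 1 s := LSeriesSummable_one_iff.2 hs
  have hterm : ∀ n : ℕ, LSeries.term (fun n : ℕ => ((mangoldtSubOne n : ℝ) : ℂ)) s n
      = (mangoldtSubOne n : ℂ) / (n : ℂ) ^ s := by
    intro n
    rcases eq_or_ne n 0 with rfl | hn
    · simp [mangoldtSubOne]
    · rw [LSeries.term_of_ne_zero hn]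
  have hsub : ∀ n : ℕ, LSeries.term (fun n : ℕ => ((mangoldtSubOne n : ℝ) : ℂ)) s n
      = LSeries.term (fun n : ℕ => ((vonMangoldt n : ℝ) : ℂ)) s n - LSeries.term 1 s n := by
    intro n
    rcases eq_or_ne n 0 with rfl | hn
    · simp
    · rw [LSeries.term_of_ne_zero hn, LSeries.term_of_ne_zero hn, LSeries.term_of_ne_zero hn]
      simp [mangoldtSubOne, hn, sub_div]
  have hL : HasSum (fun n : ℕ => (mangoldtSubOne n : ℂ) / (n : ℂ) ^ s)
      (-deriv riemannZeta s / riemannZeta s - riemannZeta s) := by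
    rw [← LSeries_vonMangoldt_eq_deriv_riemannZeta_div hs, ← LSeries_one_eq_riemannZeta hs]
    refine (HasSum.sub hΛ.hasSum h1.hasSum).congr_fun fun n => ?_
    rw [← hterm, hsub]
  have hp : ∀ i : ℕ, (mangoldtSubOne i : ℂ) = 0 ∨ 0 < (i : ℝ) := by
    intro i
    rcases Nat.eq_zero_or_pos i with rfl | hi
    · left; simp [mangoldtSubOne]
    · right; exact_mod_cast hi
  have key := hasSum_mellin (a := fun n : ℕ => (mangoldtSubOne n : ℂ)) (p := fun n : ℕ => (n : ℝ))
    (F := fun r => (expSeries mangoldtSubOne r : ℂ)) (s := s) hp (by linarith) ?_ ?_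
  · refine key.unique ((hL.mul_left (Complex.Gamma s)).congr_fun fun n => ?_)
    simp only [Complex.ofReal_natCast, mul_div_assoc]
  · intro t ht
    have := (summable_expSeries_of_abs_le abs_mangoldtSubOne_le ht).hasSum
    have h := Complex.hasSum_ofReal.2 this
    refine h.congr_fun fun n => ?_
    push_cast; rfl
  · have := hL.summable.norm
    refine this.congr fun n => ?_
    rcases Nat.eq_zero_or_pos n with rfl | hi
    · simp [mangoldtSubOne]
    · rw [norm_div, Complex.norm_natCast_cpow_of_pos hi]

/-- At a zero of finite order, differentiation lowers the order by one, whereas multiplication by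
the analytic k cannot lower it. The order must therefore be infinite. -/
lemma zero_of_deriv_eq_mul {f k : ℂ → ℂ} {z : ℂ} (hf : AnalyticAt ℂ f z) (hk : AnalyticAt ℂ k z)
    (h : ∀ᶠ w in nhds z, deriv f w = k w * f w) (hz : f z = 0) : ∀ᶠ w in nhds z, f w = 0 := by
  rw [← analyticOrderAt_eq_top]
  by_contra hne
  have h1 := hf.analyticOrderAt_deriv_add_one
  simp only [hz, sub_zero] at h1
  have h2 : analyticOrderAt (deriv f) z = analyticOrderAt k z + analyticOrderAt f z := by
    rw [analyticOrderAt_congr h]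
    exact analyticOrderAt_mul hk hf
  rw [h2] at h1
  change analyticOrderAt k z + analyticOrderAt f z + 1 = analyticOrderAt f z at h1
  obtain ⟨n, hn⟩ := ENat.ne_top_iff_exists.1 hne
  rw [← hn] at h1
  have : (n : ℕ∞) + 1 ≤ n := by
    conv_rhs => rw [← h1]
    gcongr
    exact le_add_self
  have : n + 1 ≤ n := by exact_mod_cast this
  omega

/-- If the exponential series of `Λ - 1` is `O(r^{-c})` at `0` for every `c > 1/2`, then `ζ` has no
zeros in the half plane `Re s > 1/2`. -/
lemma riemannZeta₁_ne_zero_of_isBigO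
    (h : ∀ c : ℝ, 1 / 2 < c →
      expSeries mangoldtSubOne =O[nhdsWithin 0 (Set.Ioi 0)] fun r => r ^ (-c))
    {s : ℂ} (hs : 1 / 2 < s.re) : riemannZeta₁ s ≠ 0 := by
  set H : ℂ → ℂ := mellin (fun r => (expSeries mangoldtSubOne r : ℂ)) with hH
  set U : Set ℂ := {s : ℂ | 1 / 2 < s.re} with hU
  have hUo : IsOpen U := isOpen_lt continuous_const Complex.continuous_re
  have hUc : IsPreconnected U := (convex_halfSpace_re_gt (1 / 2)).isPreconnected
  have hHd : DifferentiableOn ℂ H U := by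
    intro z hz
    obtain ⟨c, hc1, hc2⟩ := exists_between (show 1 / 2 < z.re from hz)
    have hc := continuousOn_expSeries abs_mangoldtSubOne_le
    refine (mellin_differentiableAt_of_isBigO_rpow_exp (a := 1 / 2) (b := c) (by norm_num) ?_ ?_ ?_
      hc2).differentiableWithinAt
    · exact (Complex.continuous_ofReal.comp_continuousOn hc).locallyIntegrableOn measurableSet_Ioi
    · exact (Complex.isBigO_ofReal_left.2 (expSeries_isBigO_exp (by simp [mangoldtSubOne])
        abs_mangoldtSubOne_le))
    · exact Complex.isBigO_ofReal_left.2 (h c hc1)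
  have hZ : Differentiable ℂ riemannZeta₁ := differentiable_riemannZeta₁
  have hΓ : DifferentiableOn ℂ Complex.Gamma U := by
    intro z hz
    refine (Complex.differentiableAt_Gamma z fun m hm => ?_).differentiableWithinAt
    have hz' : 1 / 2 < z.re := hz
    rw [hm] at hz'
    simp at hz'
    linarith [Nat.cast_nonneg (α := ℝ) m]
  have hΓ0 : ∀ z ∈ U, Complex.Gamma z ≠ 0 := fun z hz =>
    Complex.Gamma_ne_zero_of_re_pos (lt_trans (by norm_num) (show 1 / 2 < z.re from hz))
  -- The Mellin formula is cleared of denominators so that both sides are analytic on the whole half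
  -- plane, including s = 1 and possible zeros; it then extends from Re z > 1.
  have hid : Set.EqOn (fun z => H z * (z - 1) * riemannZeta₁ z)
      (fun z => Complex.Gamma z * (-(z - 1) * deriv riemannZeta₁ z + riemannZeta₁ z
        - riemannZeta₁ z ^ 2)) U := by
    have ha1 : AnalyticOnNhd ℂ (fun z => H z * (z - 1) * riemannZeta₁ z) U := by
      refine DifferentiableOn.analyticOnNhd ?_ hUo
      exact (hHd.mul (by fun_prop)).mul hZ.differentiableOn
    have ha2 : AnalyticOnNhd ℂ (fun z => Complex.Gamma z * (-(z - 1) * deriv riemannZeta₁ z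
        + riemannZeta₁ z - riemannZeta₁ z ^ 2)) U := by
      refine DifferentiableOn.analyticOnNhd ?_ hUo
      have := hZ.deriv
      exact hΓ.mul (by fun_prop)
    refine ha1.eqOn_of_preconnected_of_eventuallyEq ha2 hUc (z₀ := 2) (by simp [hU]; norm_num) ?_
    have : {z : ℂ | 1 < z.re} ∈ nhds (2 : ℂ) :=
      (isOpen_lt continuous_const Complex.continuous_re).mem_nhds (by simp)
    filter_upwards [this] with z hz
    have hz' : 1 < z.re := hz
    have hz1 : z ≠ 1 := by rintro rfl; simp at hz'
    have hz1' : z - 1 ≠ 0 := sub_ne_zero.2 hz1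
    have hζ : riemannZeta z ≠ 0 := riemannZeta_ne_zero_of_one_lt_re hz'
    rw [hH, mellin_mangoldtSubOne hz']
    rw [deriv_riemannZeta_eq_neg_inv_sub_sq_mul_add hz1]
    rw [riemannZeta_eq_inv_sub_mul hz1] at hζ ⊢
    have hZ0 : riemannZeta₁ z ≠ 0 := right_ne_zero_of_mul hζ
    field_simp
    ring
  intro hs0
  have hs1 : s ≠ 1 := by rintro rfl; simp at hs0
  -- Solving the identity for the derivative uses that Γ and w - 1 do not vanish near s.
  have hloc : ∀ᶠ w in nhds s, deriv riemannZeta₁ w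
      = ((1 - riemannZeta₁ w - H w * (w - 1) / Complex.Gamma w) / (w - 1)) * riemannZeta₁ w := by
    filter_upwards [hUo.mem_nhds hs, isOpen_ne.mem_nhds hs1] with w hw hw1
    have h1 := hid hw
    have h2 : w - 1 ≠ 0 := sub_ne_zero.2 hw1
    have h3 := hΓ0 w hw
    dsimp only at h1
    field_simp
    linear_combination h1
  have hk : AnalyticAt ℂ
      (fun w => (1 - riemannZeta₁ w - H w * (w - 1) / Complex.Gamma w) / (w - 1)) s := by
    have a1 : AnalyticAt ℂ H s := hHd.analyticAt (hUo.mem_nhds hs)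
    have a2 : AnalyticAt ℂ Complex.Gamma s := hΓ.analyticAt (hUo.mem_nhds hs)
    have a3 : AnalyticAt ℂ riemannZeta₁ s := hZ.analyticAt s
    have a4 := hΓ0 s hs
    have a5 : s - 1 ≠ 0 := sub_ne_zero.2 hs1
    fun_prop (disch := assumption)
  have hev := zero_of_deriv_eq_mul (hZ.analyticAt s) hk hloc hs0
  have hall : Set.EqOn riemannZeta₁ 0 Set.univ :=
    AnalyticOnNhd.eqOn_zero_of_preconnected_of_eventuallyEq_zero (fun z _ => hZ.analyticAt z)
      isPreconnected_univ (Set.mem_univ s) hev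
  have := hall (Set.mem_univ 1)
  simp at this

/-- For a zero with Re s < 1/2, the functional equation at 1 - s has all factors nonzero except the
cosine. Its zeros give s = -2k, hence only trivial zeros. -/
lemma riemannHypothesis_of_ne_zero (h : ∀ s : ℂ, 1 / 2 < s.re → riemannZeta₁ s ≠ 0) :
    RiemannHypothesis := by
  have hζ : ∀ s : ℂ, 1 / 2 < s.re → s ≠ 1 → riemannZeta s ≠ 0 := by
    intro s hs hs1
    rw [riemannZeta_eq_inv_sub_mul hs1]
    exact mul_ne_zero (inv_ne_zero (sub_ne_zero.2 hs1)) (h s hs)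
  intro s hs0 hst hs1
  rcases lt_trichotomy s.re (1 / 2) with hlt | heq | hgt
  · exfalso
    have hw : 1 / 2 < (1 - s).re := by simp; linarith
    have hs00 : s ≠ 0 := by rintro rfl; simp [riemannZeta_zero] at hs0
    have hw1 : (1 - s) ≠ 1 := by simpa using hs00
    have hn : ∀ n : ℕ, (1 - s) ≠ -n := by
      intro n hn
      rw [hn] at hw
      simp at hw
      linarith [Nat.cast_nonneg (α := ℝ) n]
    have hfe := riemannZeta_one_sub hn hw1
    rw [sub_sub_cancel, hs0] at hfe
    have hcos : Complex.cos (π * (1 - s) / 2) = 0 := by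
      have h1 := hζ _ hw hw1
      have h2 : Complex.Gamma (1 - s) ≠ 0 :=
        Complex.Gamma_ne_zero_of_re_pos (lt_trans (by norm_num) hw)
      have h3 : (2 * (π : ℂ)) ^ (-(1 - s)) ≠ 0 := by
        rw [Ne, Complex.cpow_eq_zero_iff]
        simp [Real.pi_ne_zero]
      by_contra h4
      exact mul_ne_zero (mul_ne_zero (mul_ne_zero (mul_ne_zero two_ne_zero h3) h2) h4) h1 hfe.symm
    obtain ⟨k, hk⟩ := Complex.cos_eq_zero_iff.1 hcos
    have hpi : (π : ℂ) ≠ 0 := by exact_mod_cast Real.pi_ne_zero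
    have hsk : s = -2 * k := by
      have : (π : ℂ) * (1 - s) = π * (2 * k + 1) := by linear_combination 2 * hk
      have := mul_left_cancel₀ hpi this
      linear_combination -this
    have hk0 : -1 / 4 < (k : ℝ) := by
      rw [hsk] at hlt
      simp at hlt
      linarith
    have hk1 : 0 < k := by
      have : (-1 : ℝ) < k := by linarith
      have h1 : (-1 : ℤ) < k := by exact_mod_cast this
      have h2 : k ≠ 0 := by rintro rfl; simp at hsk; exact hs00 hsk
      omega
    -- Trivial zeros are indexed as -2(n + 1) with n ≥ 0, so n = k - 1; k = 0 was excluded by ζ(0) ≠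
    -- 0.
    refine hst ⟨(k - 1).toNat, ?_⟩
    rw [hsk]
    have : (((k - 1).toNat : ℤ) : ℂ) = ((k - 1 : ℤ) : ℂ) := by
      rw [Int.toNat_of_nonneg (by omega)]
    rw [Int.cast_natCast] at this
    rw [this]
    push_cast
    ring
  · exact heq
  · exact absurd hs0 (hζ s hgt hs1)

end Converse

/-! ### Polynomial growth of (s-1)ζ(s), and a lower bound on Re s = 2 -/

section ZetaBound

open MeasureTheory

/-- The fractional part, cut off to `t > 1`. -/
noncomputable def fractTail (t : ℝ) : ℂ := Set.indicator (Set.Ioi 1) (fun t => ((Int.fract t : ℝ) : ℂ)) t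

lemma norm_fractTail_le (t : ℝ) : ‖fractTail t‖ ≤ 1 := by
  unfold fractTail
  by_cases h : t ∈ Set.Ioi (1 : ℝ)
  · rw [Set.indicator_of_mem h, Complex.norm_real, Real.norm_of_nonneg (Int.fract_nonneg t)]
    exact (Int.fract_lt_one t).le
  · rw [Set.indicator_of_notMem h]; simp

lemma measurable_fractTail : Measurable fractTail :=
  (Complex.measurable_ofReal.comp measurable_fract).indicator measurableSet_Ioi

lemma mellin_fractTail (s : ℂ) :
    mellin fractTail (-s) = ∫ t in Set.Ioi (1 : ℝ), ((Int.fract t : ℝ) : ℂ) * (t : ℂ) ^ (-(s + 1)) := by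
  rw [mellin, ← integral_indicator measurableSet_Ioi, ← integral_indicator measurableSet_Ioi]
  congr 1
  ext t
  by_cases h1 : t ∈ Set.Ioi (1 : ℝ)
  · have h0 : t ∈ Set.Ioi (0 : ℝ) := Set.mem_Ioi.2 (lt_trans zero_lt_one (Set.mem_Ioi.1 h1))
    rw [Set.indicator_of_mem h0, Set.indicator_of_mem h1, fractTail, Set.indicator_of_mem h1,
      smul_eq_mul, mul_comm]
    congr 2; ring
  · by_cases h0 : t ∈ Set.Ioi (0 : ℝ)
    · rw [Set.indicator_of_mem h0, Set.indicator_of_notMem h1, fractTail,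
        Set.indicator_of_notMem h1, smul_zero]
    · rw [Set.indicator_of_notMem h0, Set.indicator_of_notMem h1]

lemma norm_mellin_fractTail_le {s : ℂ} (hs : 0 < s.re) : ‖mellin fractTail (-s)‖ ≤ 1 / s.re := by
  rw [mellin_fractTail]
  have hint : IntegrableOn (fun t : ℝ => t ^ (-s.re - 1)) (Set.Ioi 1) :=
    integrableOn_Ioi_rpow_of_lt (by linarith) zero_lt_one
  refine (norm_integral_le_of_norm_le hint ?_).trans_eq ?_
  · refine (ae_restrict_mem measurableSet_Ioi).mono fun t ht => ?_
    have ht0 : 0 < t := lt_trans zero_lt_one ht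
    rw [norm_mul, Complex.norm_cpow_eq_rpow_re_of_pos ht0, Complex.norm_real,
      Real.norm_of_nonneg (Int.fract_nonneg t)]
    have e : (-(s + 1)).re = -s.re - 1 := by simp; ring
    rw [e]
    exact mul_le_of_le_one_left (by positivity) (Int.fract_lt_one t).le
  · rw [integral_Ioi_rpow_of_lt (by linarith) zero_lt_one]
    simp

lemma differentiableAt_mellin_fractTail {s : ℂ} (hs : s.re < 0) :
    DifferentiableAt ℂ (mellin fractTail) s := by
  refine mellin_differentiableAt_of_isBigO_rpow (a := 0) (b := s.re - 1) ?_ ?_ hs ?_ (by linarith)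
  · refine LocallyIntegrable.locallyIntegrableOn ?_ _
    refine (locallyIntegrable_const (1 : ℝ)).mono measurable_fractTail.aestronglyMeasurable ?_
    exact Eventually.of_forall fun t => by simpa using norm_fractTail_le t
  · refine IsBigO.of_bound 1 (Eventually.of_forall fun t => ?_)
    simpa using norm_fractTail_le t
  · refine (EventuallyEq.isBigO (f₂ := fun _ => (0 : ℂ)) ?_).trans (isBigO_zero _ _)
    filter_upwards [Ioo_mem_nhdsGT (zero_lt_one (α := ℝ))] with t ht
    exact Set.indicator_of_notMem (fun h => absurd ht.2 (not_lt.2 (le_of_lt h))) _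

/-- Abel summation gives ζ(s) = s∫_1^∞ ⌊t⌋ t^{-s-1} dt; writing ⌊t⌋ = t - {t} isolates the pole. -/
lemma riemannZeta₁_eq_of_one_lt_re {s : ℂ} (hs : 1 < s.re) :
    riemannZeta₁ s = s - s * (s - 1) * mellin fractTail (-s) := by
  have hs1 : s ≠ 1 := by rintro rfl; simp at hs
  have hs1' : s - 1 ≠ 0 := sub_ne_zero.2 hs1
  have h1 := LSeries_eq_mul_integral' (1 : ℕ → ℂ) zero_le_one hs (by
    refine IsBigO.of_bound 1 (Eventually.of_forall fun n => ?_)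
    simp)
  rw [LSeries_one_eq_riemannZeta hs] at h1
  have hint1 : IntegrableOn (fun t : ℝ => (t : ℂ) ^ (-s)) (Set.Ioi 1) :=
    integrableOn_Ioi_cpow_of_lt (by simpa using hs) zero_lt_one
  have hint2 : IntegrableOn (fun t : ℝ => ((Int.fract t : ℝ) : ℂ) * (t : ℂ) ^ (-(s + 1))) (Set.Ioi 1) := by
    refine (integrableOn_Ioi_cpow_of_lt (a := -(s + 1)) (by simp; linarith)
      zero_lt_one).norm.mono' ?_ ?_
    · refine Measurable.aestronglyMeasurable ?_
      exact (Complex.measurable_ofReal.comp measurable_fract).mul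
        (Complex.measurable_ofReal.pow_const _)
    · refine Eventually.of_forall fun t => ?_
      rw [norm_mul, Complex.norm_real, Real.norm_of_nonneg (Int.fract_nonneg t)]
      exact mul_le_of_le_one_left (norm_nonneg _) (Int.fract_lt_one t).le
  have h2 : ∫ t in Set.Ioi (1 : ℝ), (∑ k ∈ Finset.Icc 1 ⌊t⌋₊, (1 : ℕ → ℂ) k) * (t : ℂ) ^ (-(s + 1))
      = 1 / (s - 1) - mellin fractTail (-s) := by
    have h3 : ∫ t in Set.Ioi (1 : ℝ), (t : ℂ) ^ (-s) = 1 / (s - 1) := by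
      rw [integral_Ioi_cpow_of_lt (by simpa using hs) zero_lt_one]
      have h4 : -s + 1 ≠ 0 := by intro h; apply hs1'; linear_combination -h
      simp only [Complex.ofReal_one, Complex.one_cpow]
      rw [div_eq_div_iff h4 hs1']; ring
    rw [← h3, mellin_fractTail, ← integral_sub hint1 hint2]
    refine setIntegral_congr_fun measurableSet_Ioi fun t ht => ?_
    have ht0 : 0 < t := lt_trans zero_lt_one ht
    have e1 : (∑ k ∈ Finset.Icc 1 ⌊t⌋₊, (1 : ℕ → ℂ) k) = (t : ℂ) - ((Int.fract t : ℝ) : ℂ) := by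
      have : (⌊t⌋₊ : ℝ) = t - Int.fract t := by
        rw [natCast_floor_eq_intCast_floor ht0.le, Int.self_sub_fract]
      simp only [Pi.one_apply, Finset.sum_const, Nat.card_Icc, add_tsub_cancel_right, nsmul_eq_mul,
        mul_one]
      exact_mod_cast congrArg ((↑) : ℝ → ℂ) this
    have e2 : (t : ℂ) * (t : ℂ) ^ (-(s + 1)) = (t : ℂ) ^ (-s) := by
      have ht' : (t : ℂ) ≠ 0 := by exact_mod_cast ht0.ne'
      rw [show -s = 1 + -(s + 1) by ring, Complex.cpow_add _ _ ht', Complex.cpow_one]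
    simp only [e1]
    rw [sub_mul, e2]
  rw [h2, riemannZeta_eq_inv_sub_mul hs1] at h1
  field_simp at h1 ⊢
  linear_combination h1

/-- The fractional-part integral is holomorphic for Re s > 0, so the identity theorem extends the
formula and with it the growth bound. -/
lemma riemannZeta₁_eq {s : ℂ} (hs : 0 < s.re) :
    riemannZeta₁ s = s - s * (s - 1) * mellin fractTail (-s) := by
  have hUo : IsOpen {s : ℂ | 0 < s.re} := isOpen_lt continuous_const Complex.continuous_re
  have ha1 : AnalyticOnNhd ℂ riemannZeta₁ {s : ℂ | 0 < s.re} :=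
    fun z _ => differentiable_riemannZeta₁.analyticAt z
  have ha2 : AnalyticOnNhd ℂ (fun s => s - s * (s - 1) * mellin fractTail (-s))
      {s : ℂ | 0 < s.re} := by
    refine DifferentiableOn.analyticOnNhd (fun z hz => ?_) hUo
    have hz' : 0 < z.re := hz
    have h1 : DifferentiableAt ℂ (fun s => mellin fractTail (-s)) z :=
      (differentiableAt_mellin_fractTail (s := -z) (by simpa using hz')).comp z
        differentiableAt_id.neg
    exact (DifferentiableAt.sub (by fun_prop) ((by fun_prop : DifferentiableAt ℂ
      (fun s : ℂ => s * (s - 1)) z).mul h1)).differentiableWithinAt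
  refine ha1.eqOn_of_preconnected_of_eventuallyEq ha2 (convex_halfSpace_re_gt 0).isPreconnected
    (z₀ := 2) (by simp) ?_ hs
  have : {z : ℂ | 1 < z.re} ∈ nhds (2 : ℂ) :=
    (isOpen_lt continuous_const Complex.continuous_re).mem_nhds (by simp)
  filter_upwards [this] with z hz using riemannZeta₁_eq_of_one_lt_re hz

lemma norm_riemannZeta₁_le {s : ℂ} (hs : 1 / 2 ≤ s.re) :
    ‖riemannZeta₁ s‖ ≤ 2 * (1 + ‖s‖) ^ 2 := by
  rw [riemannZeta₁_eq (by linarith)]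
  have h1 := norm_mellin_fractTail_le (s := s) (by linarith)
  have h2 : 1 / s.re ≤ 2 := by
    rw [div_le_iff₀ (by linarith)]; linarith
  have h3 : ‖s - 1‖ ≤ ‖s‖ + 1 := by simpa using norm_sub_le s 1
  calc _ ≤ ‖s‖ + ‖s‖ * ‖s - 1‖ * ‖mellin fractTail (-s)‖ := by
        rw [← norm_mul, ← norm_mul]; exact norm_sub_le _ _
    _ ≤ ‖s‖ + ‖s‖ * (‖s‖ + 1) * 2 := by gcongr; exact h1.trans h2
    _ ≤ _ := by nlinarith [norm_nonneg s]

lemma norm_riemannZeta_two_add_ge (t : ℝ) : 3 / 10 ≤ ‖riemannZeta (2 + t * Complex.I)‖ := by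
  have hre : 1 < (2 + t * Complex.I).re := by simp
  have hre2 : (2 + t * Complex.I).re = 2 := by simp
  have h0 : Summable fun n : ℕ => 1 / ((n : ℂ) + 1) ^ (2 + t * Complex.I) := by
    have := (summable_nat_add_iff 1).2 (Complex.summable_one_div_nat_cpow.2 hre)
    simpa using this
  have h1 := h0.hasSum
  rw [← zeta_eq_tsum_one_div_nat_add_one_cpow hre] at h1
  have h2 := (hasSum_nat_add_iff' 1).2 h1
  simp only [Finset.range_one, Finset.sum_singleton, Nat.cast_zero, zero_add, Complex.one_cpow,
    div_one] at h2
  have h3 := (hasSum_nat_add_iff' 2).2 hasSum_zeta_two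
  simp only [Finset.sum_range_succ, Finset.range_zero, Finset.sum_empty, Nat.cast_zero,
    Nat.cast_one, one_pow, div_one] at h3
  -- The bound is ζ(2) - 1. The subtracted terms are n = 0, where 1/0² is 0 by convention, and n =
  -- 1.
  have h4 : ‖riemannZeta (2 + t * Complex.I) - 1‖ ≤ Real.pi ^ 2 / 6 - (0 + 1 / 0 ^ 2 + 1) := by
    rw [← h2.tsum_eq]
    refine tsum_of_norm_bounded h3 fun n => ?_
    have : ((n + 1 : ℕ) : ℂ) + 1 = ((n + 2 : ℕ) : ℂ) := by push_cast; ring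
    rw [this, norm_div, norm_one, Complex.norm_natCast_cpow_of_pos (by omega), hre2]
    simp
  have h5 : Real.pi ^ 2 / 6 - (0 + 1 / 0 ^ 2 + 1) ≤ 7 / 10 := by
    have := Real.pi_lt_d2
    have := Real.pi_pos
    norm_num
    nlinarith
  have h6 := norm_sub_norm_le (1 : ℂ) (1 - riemannZeta (2 + t * Complex.I))
  rw [norm_sub_rev 1 (riemannZeta _), sub_sub_cancel, norm_one] at h6
  linarith

lemma norm_riemannZeta₁_two_add_ge (t : ℝ) : 3 / 10 ≤ ‖riemannZeta₁ (2 + t * Complex.I)‖ := by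
  have hre : ((2 + t * Complex.I) - 1).re = 1 := by simp; norm_num
  have h1 : (2 + t * Complex.I) ≠ 1 := by
    intro h; rw [h] at hre; simp at hre
  have h2 := riemannZeta_eq_inv_sub_mul h1
  have h3 : riemannZeta₁ (2 + t * Complex.I)
      = ((2 + t * Complex.I) - 1) * riemannZeta (2 + t * Complex.I) := by
    rw [h2]; field_simp [sub_ne_zero.2 h1]
  rw [h3, norm_mul]
  have h4 : 1 ≤ ‖(2 + t * Complex.I) - 1‖ := by
    calc (1 : ℝ) = |((2 + t * Complex.I) - 1).re| := by rw [hre, abs_one]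
      _ ≤ _ := Complex.abs_re_le_norm _
  nlinarith [norm_riemannZeta_two_add_ge t]

end ZetaBound

/-! ### The logarithmic derivative in a zero-free half plane -/

section LogDeriv

open Metric

/-- A nonvanishing holomorphic function on a disc is `f c * exp g` with `g c = 0`. -/
lemma exists_eq_mul_exp_of_ne_zero {f : ℂ → ℂ} {c : ℂ} {R : ℝ} (hR : 0 < R)
    (hf : DifferentiableOn ℂ f (ball c R)) (hf0 : ∀ z ∈ ball c R, f z ≠ 0) :
    ∃ g : ℂ → ℂ, g c = 0 ∧ (∀ z ∈ ball c R, HasDerivAt g (logDeriv f z) z) ∧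
      ∀ z ∈ ball c R, f z = f c * Complex.exp (g z) := by
  have hd : DifferentiableOn ℂ (logDeriv f) (ball c R) := by
    have h1 := hf.deriv isOpen_ball
    exact h1.div hf hf0
  obtain ⟨g, hg0, hg⟩ := hd.isExactOn_ball.with_val_at c 0
  refine ⟨g, hg0, hg, fun z hz => ?_⟩
  have hconst : ∀ w ∈ ball c R, HasDerivAt (fun w => f w * Complex.exp (-g w)) 0 w := by
    intro w hw
    have h1 := (hf.differentiableAt (isOpen_ball.mem_nhds hw)).hasDerivAt
    have h2 := (hg w hw).neg.cexp
    refine (h1.mul h2).congr_deriv ?_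
    have := hf0 w hw
    rw [logDeriv_apply]
    field_simp
    ring
  have hc : c ∈ ball c R := mem_ball_self hR
  have := (convex_ball c R).is_const_of_fderivWithin_eq_zero (𝕜 := ℂ)
    (f := fun w => f w * Complex.exp (-g w))
    (fun w hw => (hconst w hw).differentiableAt.differentiableWithinAt)
    (fun w hw => by
      rw [fderivWithin_of_isOpen isOpen_ball hw]
      ext
      simp [(hconst w hw).hasFDerivAt.fderiv]) hz hc
  simp only [hg0, neg_zero, Complex.exp_zero, mul_one] at this
  rw [← this, mul_assoc, ← Complex.exp_add]
  simp

/-- The logarithmic derivative of a nonvanishing holomorphic function of moderate size. -/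
lemma norm_logDeriv_le_of_norm_le {f : ℂ → ℂ} {c : ℂ} {r R M : ℝ} (hr : 0 ≤ r) (hrR : r < R)
    (hM : 1 < M) (hf : DifferentiableOn ℂ f (ball c R)) (hf0 : ∀ z ∈ ball c R, f z ≠ 0)
    (hfM : ∀ z ∈ ball c R, ‖f z‖ ≤ M * ‖f c‖) {z : ℂ} (hz : z ∈ closedBall c r) :
    ‖logDeriv f z‖ ≤ 8 * R / (R - r) ^ 2 * Real.log M := by
  have hR : 0 < R := lt_of_le_of_lt hr hrR
  obtain ⟨g, hg0, hg, hfg⟩ := exists_eq_mul_exp_of_ne_zero hR hf hf0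
  have hfc : 0 < ‖f c‖ := norm_pos_iff.2 (hf0 c (mem_ball_self hR))
  have hlog : 0 < Real.log M := Real.log_pos hM
  have hsh : ∀ w ∈ ball (0 : ℂ) R, c + w ∈ ball c R := fun w hw => by simpa using hw
  have hgd : DifferentiableOn ℂ (fun w => g (c + w)) (ball 0 R) := fun w hw =>
    ((hg _ (hsh w hw)).differentiableAt.comp w (by fun_prop)).differentiableWithinAt
  -- Since |f| = |f(c)|·e^{Re g}, the size hypothesis is a one-sided bound on Re g, as
  -- Borel–Carathéodory requires.
  have hmaps : Set.MapsTo (fun w => g (c + w)) (ball 0 R) {z | z.re ≤ Real.log M} := by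
    intro w hw
    have h1 := hfM _ (hsh w hw)
    rw [hfg _ (hsh w hw), norm_mul, Complex.norm_exp, mul_comm] at h1
    exact (Real.le_log_iff_exp_le (by linarith)).2 (le_of_mul_le_mul_right h1 hfc)
  -- The circle about z lies within (R + r)/2 of c, midway to the boundary; Cauchy's estimate on it
  -- bounds g' = f'/f.
  have hbound : ∀ w ∈ sphere z ((R - r) / 2), ‖g w‖ ≤ 4 * R / (R - r) * Real.log M := by
    intro w hw
    have h1 : ‖w - c‖ ≤ (R + r) / 2 := by
      have h2 : ‖w - z‖ = (R - r) / 2 := by simpa [dist_eq_norm] using hw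
      have h3 : ‖z - c‖ ≤ r := by simpa [dist_eq_norm] using hz
      calc ‖w - c‖ = ‖(w - z) + (z - c)‖ := by congr 1; ring
        _ ≤ _ := (norm_add_le _ _).trans (by linarith)
    have h4 : w - c ∈ ball (0 : ℂ) R := by simpa using lt_of_le_of_lt h1 (by linarith)
    have h5 := Complex.borelCaratheodory_zero hlog hgd hmaps hR h4 (by simpa using hg0)
    simp only [add_sub_cancel] at h5
    refine h5.trans ?_
    have h6 : 0 < (R - r) / 2 := by linarith
    calc 2 * Real.log M * ‖w - c‖ / (R - ‖w - c‖) ≤ 2 * Real.log M * R / ((R - r) / 2) := by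
          gcongr <;> linarith
      _ = _ := by field_simp; ring
  have hzR : z ∈ ball c R := closedBall_subset_ball hrR hz
  have hdiff : DiffContOnCl ℂ g (ball z ((R - r) / 2)) := by
    refine DifferentiableOn.diffContOnCl fun w hw => ?_
    have hw' := closure_ball_subset_closedBall hw
    refine (hg w ?_).differentiableAt.differentiableWithinAt
    have h2 : dist w z ≤ (R - r) / 2 := hw'
    have h3 : dist z c ≤ r := hz
    exact lt_of_le_of_lt (dist_triangle w z c) (by linarith)
  have := Complex.norm_deriv_le_of_forall_mem_sphere_norm_le (by linarith) hdiff hbound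
  rw [(hg z hzR).deriv] at this
  refine this.trans_eq ?_
  have : R - r ≠ 0 := by linarith
  field_simp
  ring

/-- In a half plane free of zeros, `ζ₁'/ζ₁` grows slower than any power in vertical strips. -/
lemma exists_norm_logDeriv_riemannZeta₁_le (h0 : ∀ s : ℂ, 1 / 2 < s.re → riemannZeta₁ s ≠ 0)
    {δ η : ℝ} (hδ : 0 < δ) (hδ1 : δ ≤ 3 / 2) (hη : 0 < η) :
    ∃ C : ℝ, 0 ≤ C ∧ ∀ s : ℂ, 1 / 2 + δ ≤ s.re → s.re ≤ 2 →
      ‖logDeriv riemannZeta₁ s‖ ≤ C * (1 + |s.im|) ^ η := by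
  refine ⟨8 * (3 / 2) / (3 / 2 - (3 / 2 - δ)) ^ 2 * (500 ^ (η / 2) / (η / 2)), by positivity,
    fun s hs1 hs2 => ?_⟩
  set t := s.im
  set c : ℂ := 2 + t * Complex.I with hc
  have ht : 0 ≤ |t| := abs_nonneg t
  have hsc : s - c = ((s.re - 2 : ℝ) : ℂ) := by
    apply Complex.ext <;> simp [hc, t]
  have hmem : s ∈ closedBall c (3 / 2 - δ) := by
    rw [mem_closedBall, dist_eq_norm, hsc, Complex.norm_real, Real.norm_eq_abs, abs_le]
    constructor <;> linarith
  have hre : ∀ z ∈ ball c (3 / 2), 1 / 2 < z.re := by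
    intro z hz
    have h1 : |(z - c).re| < 3 / 2 := (Complex.abs_re_le_norm _).trans_lt (by
      simpa [dist_eq_norm] using hz)
    have h2 := (abs_lt.1 h1).1
    simp [hc] at h2
    linarith
  -- The disc of radius 3/2 about 2 + it reaches just to the line Re s = 1/2. The constant 500
  -- suffices since 2·5² ≤ 500·(3/10), with 3/10 the lower bound at the centre.
  have hM : ∀ z ∈ ball c (3 / 2),
      ‖riemannZeta₁ z‖ ≤ 500 * (1 + |t|) ^ 2 * ‖riemannZeta₁ c‖ := by
    intro z hz
    have h1 := norm_riemannZeta₁_le (hre z hz).le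
    have h2 : ‖z‖ ≤ 7 / 2 + |t| := by
      have e1 : ‖z - c‖ < 3 / 2 := by simpa [dist_eq_norm] using hz
      have e2 : ‖c‖ ≤ 2 + |t| := by
        refine (norm_add_le _ _).trans ?_
        simp
      calc ‖z‖ = ‖(z - c) + c‖ := by congr 1; ring
        _ ≤ _ := (norm_add_le _ _).trans (by linarith)
    have h3 := norm_riemannZeta₁_two_add_ge t
    calc ‖riemannZeta₁ z‖ ≤ 2 * (1 + ‖z‖) ^ 2 := h1
      _ ≤ 2 * (5 * (1 + |t|)) ^ 2 := by gcongr; linarith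
      _ ≤ 500 * (1 + |t|) ^ 2 * (3 / 10) := by nlinarith [sq_nonneg (1 + |t|)]
      _ ≤ _ := by gcongr
  have hlogM : Real.log (500 * (1 + |t|) ^ 2)
      ≤ 500 ^ (η / 2) / (η / 2) * (1 + |t|) ^ η := by
    refine (Real.log_le_rpow_div (by positivity) (half_pos hη)).trans_eq ?_
    rw [Real.mul_rpow (by norm_num) (by positivity), ← Real.rpow_natCast (1 + |t|) 2,
      ← Real.rpow_mul (by positivity)]
    have : ((2 : ℕ) : ℝ) * (η / 2) = η := by push_cast; ring
    rw [this]; ring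
  have := norm_logDeriv_le_of_norm_le (f := riemannZeta₁) (c := c) (r := 3 / 2 - δ) (R := 3 / 2)
    (M := 500 * (1 + |t|) ^ 2) (by linarith) (by linarith) (by nlinarith)
    differentiable_riemannZeta₁.differentiableOn (fun z hz => h0 z (hre z hz)) hM hmem
  refine this.trans ?_
  rw [mul_assoc]
  gcongr

end LogDeriv

/-! ### Contour shifts and Perron formulas -/

section VerticalLines

open MeasureTheory Complex

lemma integrable_of_continuous_of_norm_le {f : ℝ → ℂ} {C θ : ℝ} (hθ : 1 < θ) (hf : Continuous f)
    (hb : ∀ t, ‖f t‖ ≤ C * (1 + |t|) ^ (-θ)) : Integrable f := by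
  have h1 : Integrable fun t : ℝ => (1 + ‖t‖) ^ (-θ) :=
    integrable_one_add_norm (by simpa using hθ)
  exact (h1.const_mul C).mono' hf.aestronglyMeasurable (Eventually.of_forall fun t => hb t)

/-- Shifting a vertical line of integration across a strip where the integrand is holomorphic and
decays. -/
lemma integral_vertical_line_eq {F : ℂ → ℂ} {a b C θ : ℝ} (hab : a ≤ b) (hθ : 1 < θ)
    (hd : ∀ s : ℂ, a ≤ s.re → s.re ≤ b → DifferentiableAt ℂ F s)
    (hb : ∀ s : ℂ, a ≤ s.re → s.re ≤ b → ‖F s‖ ≤ C * (1 + |s.im|) ^ (-θ)) :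
    ∫ t : ℝ, F (a + t * I) = ∫ t : ℝ, F (b + t * I) := by
  have hline : ∀ σ : ℝ, a ≤ σ → σ ≤ b → Integrable fun t : ℝ => F (σ + t * I) := by
    intro σ h1 h2
    refine integrable_of_continuous_of_norm_le hθ ?_ (C := C) fun t => ?_
    · rw [continuous_iff_continuousAt]
      intro t
      exact ContinuousAt.comp (f := fun t : ℝ => (σ + t * I : ℂ))
        (hd (σ + t * I) (by simpa using h1) (by simpa using h2)).continuousAt (by fun_prop)
    · simpa using hb (σ + t * I) (by simpa using h1) (by simpa using h2)
  have hlim : ∀ σ : ℝ, a ≤ σ → σ ≤ b →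
      Tendsto (fun T : ℝ => ∫ t in (-T)..T, F (σ + t * I)) atTop
        (nhds (∫ t : ℝ, F (σ + t * I))) := fun σ h1 h2 =>
    intervalIntegral_tendsto_integral (hline σ h1 h2) tendsto_neg_atTop_atBot tendsto_id
  have hhor : ∀ ε : ℝ, |ε| = 1 → Tendsto (fun T : ℝ => ∫ x in a..b, F (x + (ε * T : ℝ) * I)) atTop
      (nhds 0) := by
    intro ε hε
    have h1 : Tendsto (fun T : ℝ => C * (1 + T) ^ (-θ) * |b - a|) atTop (nhds 0) := by
      have h2 : Tendsto (fun T : ℝ => (1 + T) ^ (-θ)) atTop (nhds 0) :=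
        (tendsto_rpow_neg_atTop (by linarith)).comp (tendsto_atTop_add_const_left _ _ tendsto_id)
      simpa using (h2.const_mul C).mul_const |b - a|
    refine squeeze_zero_norm' ?_ h1
    filter_upwards [eventually_ge_atTop 0] with T hT
    refine intervalIntegral.norm_integral_le_of_norm_le_const fun x hx => ?_
    rw [Set.uIoc_of_le hab] at hx
    have := hb (x + (ε * T : ℝ) * I) (by simpa using hx.1.le) (by simpa using hx.2)
    simpa [abs_mul, hε, abs_of_nonneg hT] using this
  have hrect : ∀ T : ℝ, (∫ t in (-T)..T, F (b + t * I)) - ∫ t in (-T)..T, F (a + t * I)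
      = I * ((∫ x in a..b, F (x + ((-1 : ℝ) * T : ℝ) * I))
        - ∫ x in a..b, F (x + ((1 : ℝ) * T : ℝ) * I)) := by
    intro T
    have h := integral_boundary_rect_eq_zero_of_differentiableOn F (a + (-T : ℝ) * I)
      (b + (T : ℝ) * I) (fun s hs => by
        rw [mem_reProdIm] at hs
        simp only [add_re, ofReal_re, mul_re, I_re, mul_zero, ofReal_im, I_im, mul_one, sub_self,
          add_zero, Set.uIcc_of_le hab] at hs
        exact (hd s hs.1.1 hs.1.2).differentiableWithinAt)
    simp only [add_re, ofReal_re, mul_re, I_re, mul_zero, ofReal_im, I_im, mul_one, sub_self,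
      add_zero, add_im, mul_im, zero_add, smul_eq_mul] at h
    simp only [neg_mul, one_mul]
    linear_combination (-I) * h + ((∫ t in (-T)..T, F (b + t * I))
      - ∫ t in (-T)..T, F (a + t * I)) * I_mul_I
  have hdiff : Tendsto (fun T : ℝ => (∫ t in (-T)..T, F (b + t * I))
      - ∫ t in (-T)..T, F (a + t * I)) atTop (nhds 0) := by
    simp only [hrect]
    simpa using ((hhor (-1) (by simp)).sub (hhor 1 (by simp))).const_mul I
  have := tendsto_nhds_unique hdiff ((hlim b hab le_rfl).sub (hlim a le_rfl hab))
  exact (sub_eq_zero.1 this.symm).symm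

lemma one_add_abs_im_le {s : ℂ} (hs : 1 / 2 ≤ s.re) : 1 + |s.im| ≤ 3 * ‖s‖ := by
  have h1 := abs_im_le_norm s
  have h2 := (le_abs_self _).trans (abs_re_le_norm s)
  linarith

/-- The truncated powers `max (t - 1) 0 ^ j`. -/
noncomputable def truncPow (j : ℕ) (t : ℝ) : ℂ := ((max (t - 1) 0 ^ j : ℝ) : ℂ)

lemma continuous_truncPow (j : ℕ) : Continuous (truncPow j) := by
  unfold truncPow; fun_prop

lemma hasMellin_truncPow {j : ℕ} (hj : j ≠ 0) {z m : ℂ}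
    (hi : IntegrableOn (fun t : ℝ => (t : ℂ) ^ (z - 1) * ((t : ℂ) - 1) ^ j) (Set.Ioi 1))
    (hm : ∫ t in Set.Ioi (1 : ℝ), (t : ℂ) ^ (z - 1) * ((t : ℂ) - 1) ^ j = m) :
    HasMellin (truncPow j) z m := by
  have hz : ∀ t ∈ Set.Ioi (0 : ℝ) \ Set.Ioi 1, (t : ℂ) ^ (z - 1) • truncPow j t = 0 := by
    intro t ht
    have : t ≤ 1 := not_lt.1 ht.2
    simp [truncPow, max_eq_right (sub_nonpos.2 this), hj]
  have he : ∀ t ∈ Set.Ioi (1 : ℝ), (t : ℂ) ^ (z - 1) * ((t : ℂ) - 1) ^ j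
      = (t : ℂ) ^ (z - 1) • truncPow j t := by
    intro t ht
    have : 0 ≤ t - 1 := sub_nonneg.2 (le_of_lt ht)
    simp [truncPow, max_eq_left this]
  have hsub : Set.Ioi (1 : ℝ) ⊆ Set.Ioi 0 := Set.Ioi_subset_Ioi zero_le_one
  constructor
  · exact (hi.congr_fun he measurableSet_Ioi).of_forall_sdiff_eq_zero measurableSet_Ioi hz
  · rw [← hm, mellin, setIntegral_congr_fun measurableSet_Ioi he]
    exact setIntegral_eq_of_subset_of_forall_sdiff_eq_zero measurableSet_Ioi hsub hz

lemma hasMellin_truncPow_one {z : ℂ} (hz : z.re < -1) :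
    HasMellin (truncPow 1) z (1 / (z * (z + 1))) := by
  have i1 := integrableOn_Ioi_cpow_of_lt (a := z) hz zero_lt_one
  have i2 := integrableOn_Ioi_cpow_of_lt (a := z - 1) (by simp; linarith) zero_lt_one
  have he : ∀ t ∈ Set.Ioi (1 : ℝ), (t : ℂ) ^ z - (t : ℂ) ^ (z - 1)
      = (t : ℂ) ^ (z - 1) * ((t : ℂ) - 1) ^ 1 := by
    intro t ht
    have ht0 : (t : ℂ) ≠ 0 := by exact_mod_cast (lt_trans zero_lt_one (Set.mem_Ioi.1 ht)).ne'
    have : (t : ℂ) ^ z = (t : ℂ) ^ (z - 1) * t := by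
      conv_lhs => rw [show z = (z - 1) + 1 by ring, cpow_add _ _ ht0, cpow_one]
    rw [this]; ring
  have n1 : z ≠ 0 := by rintro rfl; norm_num at hz
  have n2 : z + 1 ≠ 0 := by
    intro h; rw [eq_neg_of_add_eq_zero_left h] at hz; simp at hz
  refine hasMellin_truncPow one_ne_zero ((i1.sub i2).congr_fun he measurableSet_Ioi) ?_
  rw [← setIntegral_congr_fun measurableSet_Ioi he, integral_sub i1 i2,
    integral_Ioi_cpow_of_lt hz zero_lt_one,
    integral_Ioi_cpow_of_lt (by simp; linarith) zero_lt_one]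
  simp only [ofReal_one, one_cpow, sub_add_cancel]
  field_simp
  ring

lemma hasMellin_truncPow_two {z : ℂ} (hz : z.re < -2) :
    HasMellin (truncPow 2) z (-2 / (z * (z + 1) * (z + 2))) := by
  have i0 := integrableOn_Ioi_cpow_of_lt (a := z + 1) (by simp; linarith) zero_lt_one
  have i1 := integrableOn_Ioi_cpow_of_lt (a := z) (by linarith) zero_lt_one
  have i2 := integrableOn_Ioi_cpow_of_lt (a := z - 1) (by simp; linarith) zero_lt_one
  have he : ∀ t ∈ Set.Ioi (1 : ℝ), (t : ℂ) ^ (z + 1) - 2 * (t : ℂ) ^ z + (t : ℂ) ^ (z - 1)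
      = (t : ℂ) ^ (z - 1) * ((t : ℂ) - 1) ^ 2 := by
    intro t ht
    have ht0 : (t : ℂ) ≠ 0 := by exact_mod_cast (lt_trans zero_lt_one (Set.mem_Ioi.1 ht)).ne'
    have h1 : (t : ℂ) ^ z = (t : ℂ) ^ (z - 1) * t := by
      conv_lhs => rw [show z = (z - 1) + 1 by ring, cpow_add _ _ ht0, cpow_one]
    rw [cpow_add _ _ ht0, cpow_one, h1]; ring
  have n1 : z ≠ 0 := by rintro rfl; norm_num at hz
  have n2 : z + 1 ≠ 0 := by
    intro h; rw [eq_neg_of_add_eq_zero_left h] at hz; simp at hz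
  have n3 : z + 2 ≠ 0 := by
    intro h; rw [eq_neg_of_add_eq_zero_left h] at hz; simp at hz
  have n3' : z + 1 + 1 ≠ 0 := by rwa [add_assoc, one_add_one_eq_two]
  refine hasMellin_truncPow two_ne_zero
    (((i0.sub (i1.const_mul 2)).add i2).congr_fun he measurableSet_Ioi) ?_
  rw [← setIntegral_congr_fun measurableSet_Ioi he, integral_add (f := fun t : ℝ => (t : ℂ) ^ (z + 1) - 2 * (t : ℂ) ^ z)
      (i0.sub (i1.const_mul 2)) i2,
    integral_sub i0 (i1.const_mul 2), integral_const_mul,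
    integral_Ioi_cpow_of_lt (by simp; linarith) zero_lt_one,
    integral_Ioi_cpow_of_lt (by linarith) zero_lt_one,
    integral_Ioi_cpow_of_lt (by simp; linarith) zero_lt_one]
  simp only [ofReal_one, one_cpow, sub_add_cancel]
  rw [show z + 1 + 1 = z + 2 by ring]
  field_simp
  ring

/-- Mellin inversion on Re z = -3, rewritten with z = -(s + 1) and Re s = 2; this change of variable
reverses the sign of t. -/
lemma integral_cpow_mul_of_hasMellin {f : ℝ → ℂ} {m : ℂ → ℂ} (hf : Continuous f)
    (hm : ∀ s : ℂ, s.re = 2 → HasMellin f (-(s + 1)) (m s))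
    (hint : Integrable fun t : ℝ => m (2 + t * I)) {x : ℝ} (hx : 0 < x) :
    ∫ t : ℝ, (x : ℂ) ^ ((2 + t * I) + 1) * m (2 + t * I) = 2 * Real.pi * f x := by
  have e : ∀ t : ℝ, ((-3 : ℝ) : ℂ) + t * I = -((2 + ((-t : ℝ) : ℂ) * I) + 1) := by
    intro t; push_cast; ring
  have hm' : ∀ t : ℝ, HasMellin f (((-3 : ℝ) : ℂ) + t * I) (m (2 + ((-t : ℝ) : ℂ) * I)) := by
    intro t; rw [e]; exact hm _ (by simp)
  have hv : VerticalIntegrable (mellin f) (-3 : ℝ) := by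
    have : Integrable fun t : ℝ => m (2 + ((-t : ℝ) : ℂ) * I) := hint.comp_neg
    exact this.congr (Eventually.of_forall fun t => (hm' t).2.symm)
  have hc : MellinConvergent f ((-3 : ℝ) : ℂ) := by simpa using (hm' 0).1
  have h := mellinInv_mellin_eq (-3) f hx hc hv hf.continuousAt
  rw [mellinInv] at h
  have h2 : ∫ y : ℝ, (x : ℂ) ^ (-(((-3 : ℝ) : ℂ) + y * I)) • mellin f (((-3 : ℝ) : ℂ) + y * I)
      = ∫ t : ℝ, (x : ℂ) ^ ((2 + t * I) + 1) * m (2 + t * I) := by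
    rw [← integral_neg_eq_self (fun t : ℝ => (x : ℂ) ^ ((2 + t * I) + 1) * m (2 + t * I))]
    refine integral_congr_ae (Eventually.of_forall fun t => ?_)
    dsimp only
    rw [(hm' t).2, e, neg_neg, smul_eq_mul]
  rw [h2] at h
  rw [← h, Complex.real_smul]
  have := Real.pi_ne_zero
  have h3 : (2 * (Real.pi : ℂ)) ≠ 0 := by exact_mod_cast mul_ne_zero two_ne_zero this
  push_cast
  rw [← mul_assoc, mul_one_div_cancel h3, one_mul]

lemma norm_mul_add_one_ge {s : ℂ} (hs : 1 / 2 ≤ s.re) :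
    (1 + |s.im|) ^ 2 ≤ 9 * ‖s * (s + 1)‖ := by
  have h1 := one_add_abs_im_le hs
  have h2 := one_add_abs_im_le (s := s + 1) (by simp; linarith)
  simp only [add_im, one_im, add_zero] at h2
  rw [norm_mul]
  nlinarith [abs_nonneg s.im]

lemma norm_one_div_mul_add_one_le {s : ℂ} (hs : 1 / 2 ≤ s.re) :
    ‖1 / (s * (s + 1))‖ ≤ 9 * (1 + |s.im|) ^ (-2 : ℝ) := by
  have h := norm_mul_add_one_ge hs
  have hp : 0 < (1 + |s.im|) ^ 2 := by positivity
  rw [norm_div, norm_one, Real.rpow_neg (by positivity), Real.rpow_two, ← div_eq_mul_inv,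
    div_le_div_iff₀ (by linarith) hp]
  linarith

lemma integrable_one_div_mul_add_one :
    Integrable fun t : ℝ => (1 / ((2 + t * I) * ((2 + t * I) + 1)) : ℂ) := by
  refine integrable_of_continuous_of_norm_le (θ := 2) (C := 9) (by norm_num) ?_ fun t => ?_
  · refine continuous_const.div (by fun_prop) fun t => mul_ne_zero ?_ ?_
    · exact Complex.ne_zero_of_re_pos (by simp)
    · exact Complex.ne_zero_of_re_pos (by simp; norm_num)
  · simpa using norm_one_div_mul_add_one_le (s := 2 + t * I) (by simp; norm_num)

lemma integrable_one_div_sub_one_mul :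
    Integrable fun t : ℝ => (2 / (((2 + t * I) - 1) * ((2 + t * I) * ((2 + t * I) + 1))) : ℂ) := by
  refine integrable_of_continuous_of_norm_le (θ := 2) (C := 18) (by norm_num) ?_ fun t => ?_
  · refine continuous_const.div (by fun_prop) fun t => mul_ne_zero ?_ (mul_ne_zero ?_ ?_)
    · exact Complex.ne_zero_of_re_pos (by simp)
    · exact Complex.ne_zero_of_re_pos (by simp)
    · exact Complex.ne_zero_of_re_pos (by simp; norm_num)
  · have h1 := norm_one_div_mul_add_one_le (s := 2 + t * I) (by simp; norm_num)
    have h2 : 1 ≤ ‖(2 + t * I) - 1‖ := by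
      have := (le_abs_self _).trans (abs_re_le_norm ((2 + t * I) - 1))
      have e : ((2 + t * I) - 1).re = 1 := by simp; norm_num
      rwa [e] at this
    have e : (2 / (((2 + t * I) - 1) * ((2 + t * I) * ((2 + t * I) + 1))) : ℂ)
        = 2 * (1 / ((2 + t * I) * ((2 + t * I) + 1))) / ((2 + t * I) - 1) := by
      rw [mul_one_div, div_div, mul_comm (_ - _)]
    have him : (2 + t * I).im = t := by simp
    rw [him] at h1
    rw [e, norm_div, norm_mul]
    calc _ ≤ ‖(2 : ℂ)‖ * ‖1 / ((2 + t * I) * ((2 + t * I) + 1))‖ :=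
          div_le_self (by positivity) h2
      _ ≤ 2 * (9 * (1 + |t|) ^ (-2 : ℝ)) := by
          gcongr; simp
      _ = _ := by ring

/-- Perron's formula for `max (x - 1) 0`. -/
lemma integral_perron_one {x : ℝ} (hx : 0 < x) :
    ∫ t : ℝ, (x : ℂ) ^ ((2 + t * I) + 1) * (1 / ((2 + t * I) * ((2 + t * I) + 1)))
      = 2 * Real.pi * ((max (x - 1) 0 : ℝ) : ℂ) := by
  have := integral_cpow_mul_of_hasMellin (m := fun s => 1 / (s * (s + 1))) (continuous_truncPow 1)
    (fun s hs => by
      convert hasMellin_truncPow_one (z := -(s + 1)) (by simp [hs]) using 2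
      ring)
    integrable_one_div_mul_add_one hx
  rw [this]; simp [truncPow]

/-- Perron's formula for `max (x - 1) 0 ^ 2`. -/
lemma integral_perron_two {x : ℝ} (hx : 0 < x) :
    ∫ t : ℝ, (x : ℂ) ^ ((2 + t * I) + 1)
        * (2 / (((2 + t * I) - 1) * ((2 + t * I) * ((2 + t * I) + 1))))
      = 2 * Real.pi * ((max (x - 1) 0 ^ 2 : ℝ) : ℂ) := by
  have := integral_cpow_mul_of_hasMellin (m := fun s => 2 / ((s - 1) * (s * (s + 1))))
    (continuous_truncPow 2)
    (fun s hs => by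
      convert hasMellin_truncPow_two (z := -(s + 1)) (by simp [hs]) using 1
      rw [← neg_div_neg_eq, show -((s - 1) * (s * (s + 1)))
        = -(s + 1) * (-(s + 1) + 1) * (-(s + 1) + 2) by ring])
    integrable_one_div_sub_one_mul hx
  rw [this, truncPow]

end VerticalLines

/-! ### The prime number theorem with square-root error -/

section PrimeNumberBound

open MeasureTheory Complex ArithmeticFunction

/-- The first Riesz mean `∑_{n < N} Λ(n) (N - n)`. -/
noncomputable def mangoldtRiesz (N : ℕ) : ℝ := ∑ n ∈ Finset.range N, vonMangoldt n * ((N : ℝ) - n)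

/-- The Chebyshev function `ψ(N)`. -/
noncomputable def chebyshevSum (N : ℕ) : ℝ := ∑ n ∈ Finset.range (N + 1), vonMangoldt n

lemma mangoldtRiesz_succ_sub (N : ℕ) :
    mangoldtRiesz (N + 1) - mangoldtRiesz N = chebyshevSum N := by
  have h : mangoldtRiesz N = ∑ n ∈ Finset.range (N + 1), vonMangoldt n * ((N : ℝ) - n) := by
    rw [Finset.sum_range_succ]; simp [mangoldtRiesz]
  rw [h, mangoldtRiesz, chebyshevSum, ← Finset.sum_sub_distrib]
  refine Finset.sum_congr rfl fun n _ => ?_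
  push_cast; ring

lemma LSeries_term_mul_cpow {N n : ℕ} (hn : n ≠ 0) (s : ℂ) :
    (N : ℂ) ^ (s + 1) * LSeries.term (fun n => (vonMangoldt n : ℂ)) s n
      = (vonMangoldt n * n : ℝ) * (((N : ℝ) / n : ℝ) : ℂ) ^ (s + 1) := by
  have hn' : (n : ℂ) ≠ 0 := by exact_mod_cast hn
  rw [LSeries.term_of_ne_zero hn, ofReal_div, div_eq_mul_inv ((N : ℝ) : ℂ), ← ofReal_inv,
    mul_cpow_ofReal_nonneg (by positivity) (by positivity), ofReal_inv, inv_cpow _ _ (by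
      rw [ofReal_natCast, natCast_arg]; exact Real.pi_pos.ne), ofReal_natCast, ofReal_natCast,
    cpow_add _ _ hn', cpow_one]
  push_cast
  have : (n : ℂ) ^ s ≠ 0 := by rw [Ne, cpow_eq_zero_iff]; tauto
  field_simp

/-- The Perron kernel is applied at x = N/n for each n. On Re s = 2 the modulus of Λ(n)n^{-s} does
not depend on t, which justifies summing under the integral. -/
lemma integral_perron_vonMangoldt {N : ℕ} (hN : N ≠ 0) :
    ∫ t : ℝ, (N : ℂ) ^ ((2 + t * I) + 1) * (1 / ((2 + t * I) * ((2 + t * I) + 1)))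
        * LSeries (fun n => (vonMangoldt n : ℂ)) (2 + t * I)
      = 2 * Real.pi * (mangoldtRiesz N : ℂ) := by
  have hN0 : (N : ℂ) ≠ 0 := by exact_mod_cast hN
  set K : ℝ → ℂ := fun t => (N : ℂ) ^ ((2 + t * I) + 1) * (1 / ((2 + t * I) * ((2 + t * I) + 1)))
    with hK
  have hKn : ∀ t, ‖K t‖ = (N : ℝ) ^ (3 : ℝ) * ‖(1 / ((2 + t * I) * ((2 + t * I) + 1)) : ℂ)‖ := by
    intro t
    rw [hK, norm_mul, norm_natCast_cpow_of_pos (Nat.pos_of_ne_zero hN)]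
    congr 2; simp; norm_num
  have hKi : Integrable K := by
    refine (integrable_one_div_mul_add_one.norm.const_mul ((N : ℝ) ^ (3 : ℝ))).mono'
      ((Continuous.aestronglyMeasurable (by
        refine Continuous.const_cpow (by fun_prop) (Or.inl hN0))).mul
        integrable_one_div_mul_add_one.aestronglyMeasurable)
      (Eventually.of_forall fun t => (hKn t).le)
  set F : ℕ → ℝ → ℂ := fun n t =>
    K t * LSeries.term (fun n => (vonMangoldt n : ℂ)) (2 + t * I) n with hF
  have hFeq : ∀ n : ℕ, n ≠ 0 → ∀ t, F n t = (vonMangoldt n * n : ℝ) *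
      ((((N : ℝ) / n : ℝ) : ℂ) ^ ((2 + t * I) + 1) * (1 / ((2 + t * I) * ((2 + t * I) + 1)))) := by
    intro n hn t
    have := LSeries_term_mul_cpow (N := N) hn (2 + t * I)
    simp only [hF, hK]
    linear_combination (1 / ((2 + t * I) * ((2 + t * I) + 1))) * this
  have hF0 : ∀ t, F 0 t = 0 := fun t => by simp [hF]
  have hFn : ∀ n t, ‖F n t‖
      = ‖LSeries.term (fun n => (vonMangoldt n : ℂ)) 2 n‖ * ‖K t‖ := by
    intro n t
    rw [hF, norm_mul, mul_comm, LSeries.norm_term_eq, LSeries.norm_term_eq]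
    simp
  have hFint : ∀ n, Integrable (F n) := by
    intro n
    refine (hKi.norm.const_mul ‖LSeries.term (fun n => (vonMangoldt n : ℂ)) 2 n‖).mono' ?_
      (Eventually.of_forall fun t => (hFn n t).le)
    refine hKi.aestronglyMeasurable.mul (Continuous.aestronglyMeasurable ?_)
    rcases eq_or_ne n 0 with rfl | hn
    · simp only [LSeries.term_zero]; exact continuous_const
    · have hn' : (n : ℂ) ≠ 0 := by exact_mod_cast hn
      simp only [LSeries.term_of_ne_zero hn]
      refine continuous_const.div (Continuous.const_cpow (by fun_prop) (Or.inl hn')) fun t => ?_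
      rw [Ne, cpow_eq_zero_iff]; tauto
  have hsum : Summable fun n => ∫ t, ‖F n t‖ := by
    simp only [hFn, integral_const_mul]
    exact (LSeriesSummable_vonMangoldt (s := 2) (by simp)).norm.mul_right _
  have h1 := hasSum_integral_of_summable_integral_norm hFint hsum
  have h2 : (fun n => ∫ t, F n t) = fun n : ℕ =>
      2 * Real.pi * ((vonMangoldt n * max ((N : ℝ) - n) 0 : ℝ) : ℂ) := by
    ext n
    rcases eq_or_ne n 0 with rfl | hn
    · simp [hF0]
    · have hn' : (0 : ℝ) < n := by exact_mod_cast Nat.pos_of_ne_zero hn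
      have hNr : (0 : ℝ) < N := by exact_mod_cast Nat.pos_of_ne_zero hN
      have e : (n : ℝ) * max ((N : ℝ) / n - 1) 0 = max ((N : ℝ) - n) 0 := by
        rw [mul_max_of_nonneg _ _ hn'.le, mul_zero]; congr 1; field_simp
      simp only [hFeq n hn]
      rw [integral_const_mul, integral_perron_one (div_pos hNr hn'), ← e]
      push_cast; ring
  rw [h2] at h1
  have h3 : HasSum (fun n : ℕ => 2 * Real.pi * ((vonMangoldt n * max ((N : ℝ) - n) 0 : ℝ) : ℂ))
      (2 * Real.pi * (mangoldtRiesz N : ℂ)) := by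
    have : ∀ n ∉ Finset.range N,
        2 * Real.pi * ((vonMangoldt n * max ((N : ℝ) - n) 0 : ℝ) : ℂ) = 0 := by
      intro n hn
      have : (N : ℝ) ≤ n := by exact_mod_cast not_lt.1 (fun h => hn (Finset.mem_range.2 h))
      simp [max_eq_right (sub_nonpos.2 this)]
    convert! hasSum_sum_of_ne_finset_zero (L := .unconditional ℕ) this using 1
    rw [mangoldtRiesz, ofReal_sum, Finset.mul_sum]
    refine Finset.sum_congr rfl fun n hn => ?_
    have : (n : ℝ) ≤ N := by exact_mod_cast (Finset.mem_range.1 hn).le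
    rw [max_eq_left (sub_nonneg.2 this)]
  rw [h3.unique h1]
  refine integral_congr_ae (Eventually.of_forall fun t => ?_)
  simp only [hF, tsum_mul_left]
  rfl

lemma LSeries_vonMangoldt_eq_logDeriv {s : ℂ} (hs : 1 < s.re) :
    LSeries (fun n => (vonMangoldt n : ℂ)) s = -logDeriv riemannZeta₁ s + 1 / (s - 1) := by
  have hs1 : s ≠ 1 := by rintro rfl; simp at hs
  have hs1' : s - 1 ≠ 0 := sub_ne_zero.2 hs1
  have hζ : riemannZeta s ≠ 0 := riemannZeta_ne_zero_of_one_lt_re hs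
  rw [LSeries_vonMangoldt_eq_deriv_riemannZeta_div hs,
    deriv_riemannZeta_eq_neg_inv_sub_sq_mul_add hs1, logDeriv_apply]
  rw [riemannZeta_eq_inv_sub_mul hs1] at hζ ⊢
  have hZ0 : riemannZeta₁ s ≠ 0 := right_ne_zero_of_mul hζ
  field_simp
  ring

/-- Interpolation between the mean value bound |s+1|(x+1)^σ and the trivial bound 2(x+1)^{σ+1},
where σ = Re s. A small θ buys the decay |s|^{-θ} that makes the Perron integral absolutely
convergent. -/
lemma norm_cpow_add_one_sub_le {x θ : ℝ} (hx : 0 < x) (hθ0 : 0 ≤ θ) (hθ1 : θ ≤ 1) {s : ℂ}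
    (hs : 0 < s.re) :
    ‖((x + 1 : ℝ) : ℂ) ^ (s + 1) - (x : ℂ) ^ (s + 1)‖
      ≤ 2 * ‖s + 1‖ ^ (1 - θ) * (x + 1) ^ (s.re + θ) := by
  set D := ‖((x + 1 : ℝ) : ℂ) ^ (s + 1) - (x : ℂ) ^ (s + 1)‖ with hD
  have hs1 : s + 1 ≠ 0 := Complex.ne_zero_of_re_pos (by simp; linarith)
  have h1 : D ≤ ‖s + 1‖ * (x + 1) ^ s.re := by
    have := (convex_Icc x (x + 1)).norm_image_sub_le_of_norm_hasDerivWithin_le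
      (f := fun u : ℝ => (u : ℂ) ^ (s + 1)) (f' := fun u : ℝ => (s + 1) * (u : ℂ) ^ (s + 1 - 1))
      (C := ‖s + 1‖ * (x + 1) ^ s.re) (x := x) (y := x + 1)
      (fun u hu => (hasDerivAt_ofReal_cpow_const (lt_of_lt_of_le hx hu.1).ne' hs1).hasDerivWithinAt)
      (fun u hu => by
        have hu0 : 0 < u := lt_of_lt_of_le hx hu.1
        rw [norm_mul, norm_cpow_eq_rpow_re_of_pos hu0, add_sub_cancel_right]
        gcongr
        exact hu.2)
      (Set.left_mem_Icc.2 (by linarith)) (Set.right_mem_Icc.2 (by linarith))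
    simpa [hD] using this
  have h2 : D ≤ 2 * (x + 1) ^ (s.re + 1) := by
    refine (norm_sub_le _ _).trans ?_
    rw [norm_cpow_eq_rpow_re_of_pos (by linarith), norm_cpow_eq_rpow_re_of_pos hx]
    simp only [add_re, one_re]
    have : x ^ (s.re + 1) ≤ (x + 1) ^ (s.re + 1) :=
      Real.rpow_le_rpow hx.le (by linarith) (by linarith)
    linarith
  have hD0 : 0 ≤ D := norm_nonneg _
  have hX : 0 < x + 1 := by linarith
  calc D = D ^ (1 - θ) * D ^ θ := by
        rw [← Real.rpow_add' hD0 (by norm_num)]; simp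
    _ ≤ (‖s + 1‖ * (x + 1) ^ s.re) ^ (1 - θ) * (2 * (x + 1) ^ (s.re + 1)) ^ θ := by
        gcongr
    _ = 2 ^ θ * ‖s + 1‖ ^ (1 - θ) * (x + 1) ^ (s.re + θ) := by
        rw [Real.mul_rpow (by positivity) (by positivity), Real.mul_rpow (by positivity)
          (by positivity), ← Real.rpow_mul hX.le, ← Real.rpow_mul hX.le,
          show s.re + θ = s.re * (1 - θ) + (s.re + 1) * θ by ring, Real.rpow_add hX]
        ring
    _ ≤ _ := by
        gcongr
        calc (2 : ℝ) ^ θ ≤ 2 ^ (1 : ℝ) := Real.rpow_le_rpow_of_exponent_le (by norm_num) hθ1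
          _ = 2 := Real.rpow_one 2

/-- The weight whose integrals against powers of `N` give the Riesz means of `Λ - 1`. -/
noncomputable def perronWeight (s : ℂ) : ℂ := 1 / (s * (s + 1)) * (-logDeriv riemannZeta₁ s)

lemma differentiableAt_perronWeight (h0 : ∀ s : ℂ, 1 / 2 < s.re → riemannZeta₁ s ≠ 0) {s : ℂ}
    (hs : 1 / 2 < s.re) : DifferentiableAt ℂ perronWeight s := by
  have h1 : s * (s + 1) ≠ 0 := mul_ne_zero (Complex.ne_zero_of_re_pos (by linarith))
    (Complex.ne_zero_of_re_pos (by simp; linarith))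
  have h2 : DifferentiableAt ℂ (logDeriv riemannZeta₁) s :=
    (differentiable_riemannZeta₁.deriv s).div (differentiable_riemannZeta₁ s) (h0 s hs)
  unfold perronWeight
  fun_prop (disch := assumption)

lemma norm_perronWeight_le {C η : ℝ} {s : ℂ} (hs : 1 / 2 ≤ s.re)
    (h : ‖logDeriv riemannZeta₁ s‖ ≤ C * (1 + |s.im|) ^ η) :
    ‖perronWeight s‖ ≤ 9 * C * (1 + |s.im|) ^ (-(2 - η)) := by
  have hp : 0 < 1 + |s.im| := by positivity
  rw [perronWeight, norm_mul, norm_neg]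
  calc _ ≤ 9 * (1 + |s.im|) ^ (-2 : ℝ) * (C * (1 + |s.im|) ^ η) := by
        gcongr; exact norm_one_div_mul_add_one_le hs
    _ = _ := by rw [show -(2 - η) = -2 + η by ring, Real.rpow_add hp]; ring

lemma continuous_vertical_cpow_mul_perronWeight
    (h0 : ∀ s : ℂ, 1 / 2 < s.re → riemannZeta₁ s ≠ 0) {N : ℕ} (hN : N ≠ 0) :
    Continuous fun t : ℝ => (N : ℂ) ^ ((2 + t * I) + 1) * perronWeight (2 + t * I) := by
  have hN0 : (N : ℂ) ≠ 0 := by exact_mod_cast hN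
  refine (Continuous.const_cpow (by fun_prop) (Or.inl hN0)).mul ?_
  rw [continuous_iff_continuousAt]
  intro t
  exact ContinuousAt.comp (f := fun t : ℝ => (2 + t * I : ℂ))
    (differentiableAt_perronWeight h0 (by simp; norm_num)).continuousAt (by fun_prop)

lemma integrable_cpow_mul_perronWeight
    (h0 : ∀ s : ℂ, 1 / 2 < s.re → riemannZeta₁ s ≠ 0) {N : ℕ} (hN : N ≠ 0) :
    Integrable fun t : ℝ => (N : ℂ) ^ ((2 + t * I) + 1) * perronWeight (2 + t * I) := by
  obtain ⟨C, hC, hb⟩ := exists_norm_logDeriv_riemannZeta₁_le h0 (δ := 1) (η := 1 / 2)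
    (by norm_num) (by norm_num) (by norm_num)
  refine integrable_of_continuous_of_norm_le (θ := 2 - 1 / 2) (C := (N : ℝ) ^ (3 : ℝ) * (9 * C))
    (by norm_num) (continuous_vertical_cpow_mul_perronWeight h0 hN) fun t => ?_
  have h1 := norm_perronWeight_le (s := 2 + t * I) (by simp; norm_num)
    (hb (2 + t * I) (by simp; norm_num) (by simp))
  have him : (2 + t * I).im = t := by simp
  rw [him] at h1
  rw [norm_mul, norm_natCast_cpow_of_pos (Nat.pos_of_ne_zero hN)]
  have e : (2 + t * I + 1).re = 3 := by simp; norm_num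
  rw [e, mul_assoc ((N : ℝ) ^ (3 : ℝ))]
  gcongr

lemma integral_cpow_mul_perronWeight
    (h0 : ∀ s : ℂ, 1 / 2 < s.re → riemannZeta₁ s ≠ 0) {N : ℕ} (hN : N ≠ 0) :
    ∫ t : ℝ, (N : ℂ) ^ ((2 + t * I) + 1) * perronWeight (2 + t * I)
      = 2 * Real.pi * ((mangoldtRiesz N - ((N : ℝ) - 1) ^ 2 / 2 : ℝ) : ℂ) := by
  have hNr : (1 : ℝ) ≤ N := by exact_mod_cast Nat.one_le_iff_ne_zero.2 hN
  have hN0 : (N : ℂ) ≠ 0 := by exact_mod_cast hN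
  have h2 := integral_perron_two (x := N) (by linarith)
  rw [max_eq_left (sub_nonneg.2 hNr)] at h2
  have hi2 : Integrable fun t : ℝ => ((N : ℝ) : ℂ) ^ ((2 + t * I) + 1)
      * (2 / (((2 + t * I) - 1) * ((2 + t * I) * ((2 + t * I) + 1)))) := by
    refine (integrable_one_div_sub_one_mul.norm.const_mul ((N : ℝ) ^ (3 : ℝ))).mono'
      ((Continuous.aestronglyMeasurable (by
        refine Continuous.const_cpow (by fun_prop) (Or.inl (by simpa using hN)))).mul
        integrable_one_div_sub_one_mul.aestronglyMeasurable)
      (Eventually.of_forall fun t => ?_)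
    rw [norm_mul, norm_cpow_eq_rpow_re_of_pos (by linarith)]
    have e : (2 + t * I + 1).re = 3 := by simp; norm_num
    rw [e]
  have h3 := integral_perron_vonMangoldt hN
  have h4 : ∀ t : ℝ, (N : ℂ) ^ ((2 + t * I) + 1) * (1 / ((2 + t * I) * ((2 + t * I) + 1)))
        * LSeries (fun n => (vonMangoldt n : ℂ)) (2 + t * I)
      = (N : ℂ) ^ ((2 + t * I) + 1) * perronWeight (2 + t * I)
        + 1 / 2 * (((N : ℝ) : ℂ) ^ ((2 + t * I) + 1)
      * (2 / (((2 + t * I) - 1) * ((2 + t * I) * ((2 + t * I) + 1))))) := by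
    intro t
    rw [LSeries_vonMangoldt_eq_logDeriv (by simp), perronWeight, ofReal_natCast]
    have n1 : (2 + t * I) - 1 ≠ 0 := Complex.ne_zero_of_re_pos (by simp)
    have n2 : 2 + t * I ≠ 0 := Complex.ne_zero_of_re_pos (by simp)
    have n3 : (2 + t * I) + 1 ≠ 0 := Complex.ne_zero_of_re_pos (by simp; norm_num)
    field_simp
  simp only [h4] at h3
  rw [integral_add (integrable_cpow_mul_perronWeight h0 hN) (hi2.const_mul _), integral_const_mul,
    h2] at h3
  push_cast at h3 ⊢
  linear_combination h3

/-- Differencing the Riesz means at N + 1 and N gives ψ(N), and (N² - (N-1)²)/2 = N - 1/2 explains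
the 1/2. The pole of ζ was already split off, so the shift meets no residue. -/
lemma integral_cpow_sub_mul_perronWeight (h0 : ∀ s : ℂ, 1 / 2 < s.re → riemannZeta₁ s ≠ 0) {σ : ℝ}
    (hσ : 1 / 2 < σ) (hσ2 : σ ≤ 2) {N : ℕ} (hN : N ≠ 0) :
    ∫ t : ℝ, ((((N : ℝ) + 1 : ℝ) : ℂ) ^ ((σ + t * I) + 1) - ((N : ℝ) : ℂ) ^ ((σ + t * I) + 1))
        * perronWeight (σ + t * I)
      = 2 * Real.pi * ((chebyshevSum N - N + 1 / 2 : ℝ) : ℂ) := by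
  obtain ⟨C, hC, hb⟩ := exists_norm_logDeriv_riemannZeta₁_le h0 (δ := σ - 1 / 2) (η := 1 / 2)
    (by linarith) (by linarith) (by norm_num)
  have hNr : (1 : ℝ) ≤ N := by exact_mod_cast Nat.one_le_iff_ne_zero.2 hN
  have hN0 : ((N : ℝ) : ℂ) ≠ 0 := by exact_mod_cast hN
  have hN1 : (((N : ℝ) + 1 : ℝ) : ℂ) ≠ 0 := by
    rw [Ne, ofReal_eq_zero]; linarith
  set F : ℂ → ℂ := fun s =>
    ((((N : ℝ) + 1 : ℝ) : ℂ) ^ (s + 1) - ((N : ℝ) : ℂ) ^ (s + 1)) * perronWeight s with hF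
  have hshift := integral_vertical_line_eq (F := F) (a := σ) (b := 2) (θ := 2 - 1 / 2)
    (C := 2 * ((N : ℝ) + 1) ^ (3 : ℝ) * (9 * C)) hσ2 (by norm_num)
    (fun s h1 _ => by
      refine DifferentiableAt.mul ?_ (differentiableAt_perronWeight h0 (by linarith))
      exact ((differentiableAt_id.add_const 1).const_cpow (Or.inl hN1)).sub
        ((differentiableAt_id.add_const 1).const_cpow (Or.inl hN0)))
    (fun s h1 h2 => by
      have h3 := norm_perronWeight_le (s := s) (by linarith) (hb s (by linarith) h2)
      -- Only decay in t matters for the shift, so the trivial endpoint θ = 1 is enough.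
      have h4 := norm_cpow_add_one_sub_le (x := N) (θ := 1) (by linarith) zero_le_one le_rfl
        (s := s) (by linarith)
      rw [sub_self, Real.rpow_zero, mul_one] at h4
      have h5 : ((N : ℝ) + 1) ^ (s.re + 1) ≤ ((N : ℝ) + 1) ^ (3 : ℝ) :=
        Real.rpow_le_rpow_of_exponent_le (by linarith) (by linarith)
      rw [hF, norm_mul, mul_assoc (2 * ((N : ℝ) + 1) ^ (3 : ℝ))]
      gcongr
      exact h4.trans (by gcongr))
  change ∫ t : ℝ, F (σ + t * I) = _
  rw [hshift]
  have i1 := integrable_cpow_mul_perronWeight h0 (N := N + 1) (by omega)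
  have i2 := integrable_cpow_mul_perronWeight h0 hN
  have hsplit : ∀ t : ℝ, F ((2 : ℝ) + t * I)
      = ((N + 1 : ℕ) : ℂ) ^ ((2 + t * I) + 1) * perronWeight (2 + t * I)
        - (N : ℂ) ^ ((2 + t * I) + 1) * perronWeight (2 + t * I) := by
    intro t
    simp only [hF]
    push_cast
    ring
  simp only [hsplit]
  rw [integral_sub i1 i2, integral_cpow_mul_perronWeight h0 (N := N + 1) (by omega),
    integral_cpow_mul_perronWeight h0 hN, ← mangoldtRiesz_succ_sub]
  push_cast
  ring

/-- The prime number theorem with a square root error term, in a zero-free half plane. -/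
theorem exists_abs_chebyshevSum_sub_le (h0 : ∀ s : ℂ, 1 / 2 < s.re → riemannZeta₁ s ≠ 0)
    {ε : ℝ} (hε : 0 < ε) (hε1 : ε ≤ 1) :
    ∃ C : ℝ, 0 ≤ C ∧ ∀ N : ℕ, |chebyshevSum N - N| ≤ C * ((N : ℝ) + 1) ^ (1 / 2 + ε) := by
  -- Then σ + θ = 1/2 + ε is the power of N, and with η = θ/2 the integrand decays like
  -- (1+|t|)^{-1-θ/2}.
  set θ := ε / 2 with hθ
  set σ := 1 / 2 + θ with hσ
  obtain ⟨C, hC, hb⟩ := exists_norm_logDeriv_riemannZeta₁_le h0 (δ := θ) (η := θ / 2)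
    (by linarith) (by linarith) (by linarith)
  set J := ∫ t : ℝ, (1 + ‖t‖) ^ (-(1 + θ / 2)) with hJ
  have hJint : Integrable fun t : ℝ => (1 + ‖t‖) ^ (-(1 + θ / 2)) :=
    integrable_one_add_norm (by simp; linarith)
  have hJ0 : 0 ≤ J := integral_nonneg fun t => by positivity
  -- Here 18 = 2·3·3: a 2 from the difference of powers and a 3 from each of |s|, |s+1| ≥ (1+|t|)/3.
  -- The 1 absorbs the shift by 1/2.
  refine ⟨18 * C * J + 1, by positivity, fun N => ?_⟩
  rcases eq_or_ne N 0 with rfl | hN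
  · simp [chebyshevSum]; positivity
  have hNr : (1 : ℝ) ≤ N := by exact_mod_cast Nat.one_le_iff_ne_zero.2 hN
  have hint := integral_cpow_sub_mul_perronWeight h0 (σ := σ) (by linarith) (by linarith) hN
  have hbound : ∀ t : ℝ, ‖((((N : ℝ) + 1 : ℝ) : ℂ) ^ ((σ + t * I) + 1)
      - ((N : ℝ) : ℂ) ^ ((σ + t * I) + 1)) * perronWeight (σ + t * I)‖
      ≤ 18 * C * ((N : ℝ) + 1) ^ (1 / 2 + ε) * (1 + ‖t‖) ^ (-(1 + θ / 2)) := by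
    intro t
    set s : ℂ := σ + t * I with hs
    have hre : s.re = σ := by simp [hs]
    have him : s.im = t := by simp [hs]
    have h1 := norm_cpow_add_one_sub_le (x := N) (θ := θ) (by linarith) (by linarith) (by linarith)
      (s := s) (by rw [hre]; linarith)
    have h2 := hb s (by rw [hre]) (by rw [hre]; linarith)
    have h3 := one_add_abs_im_le (s := s) (by rw [hre]; linarith)
    have h4 := one_add_abs_im_le (s := s + 1) (by simp [hre]; linarith)
    simp only [add_im, one_im, add_zero] at h4
    rw [him] at h2 h3 h4
    rw [hre, show σ + θ = 1 / 2 + ε by rw [hσ, hθ]; ring] at h1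
    have hp : 0 < 1 + |t| := by positivity
    have hs0 : 0 < ‖s‖ := by nlinarith
    have hs1 : 0 < ‖s + 1‖ := by nlinarith
    have h5 : ‖s + 1‖ ^ (-θ) ≤ 3 * (1 + |t|) ^ (-θ) := by
      calc ‖s + 1‖ ^ (-θ) ≤ ((1 + |t|) / 3) ^ (-θ) :=
            Real.rpow_le_rpow_of_nonpos (by positivity) (by linarith) (by linarith)
        _ = 3 ^ θ * (1 + |t|) ^ (-θ) := by
            rw [Real.div_rpow hp.le (by norm_num), Real.rpow_neg (by norm_num : (0 : ℝ) ≤ 3),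
              div_inv_eq_mul, mul_comm]
        _ ≤ _ := by
            gcongr
            calc (3 : ℝ) ^ θ ≤ 3 ^ (1 : ℝ) :=
                  Real.rpow_le_rpow_of_exponent_le (by norm_num) (by linarith)
              _ = 3 := Real.rpow_one 3
    have h6 : ‖s‖⁻¹ ≤ 3 * (1 + |t|) ^ (-1 : ℝ) := by
      rw [Real.rpow_neg_one, ← div_eq_mul_inv, inv_eq_one_div, div_le_div_iff₀ hs0 hp]
      linarith
    rw [norm_mul, perronWeight, norm_mul, norm_neg, norm_div, norm_one, norm_mul]
    calc _ ≤ (2 * ‖s + 1‖ ^ (1 - θ) * ((N : ℝ) + 1) ^ (1 / 2 + ε))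
          * (1 / (‖s‖ * ‖s + 1‖) * (C * (1 + |t|) ^ (θ / 2))) := by gcongr
      _ = 2 * C * ((N : ℝ) + 1) ^ (1 / 2 + ε) * (‖s‖⁻¹ * ‖s + 1‖ ^ (-θ) * (1 + |t|) ^ (θ / 2)) := by
          rw [sub_eq_add_neg, Real.rpow_add hs1, Real.rpow_one]
          field_simp
      _ ≤ 2 * C * ((N : ℝ) + 1) ^ (1 / 2 + ε)
          * (3 * (1 + |t|) ^ (-1 : ℝ) * (3 * (1 + |t|) ^ (-θ)) * (1 + |t|) ^ (θ / 2)) := by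
          gcongr
      _ = _ := by
          rw [Real.norm_eq_abs, show -(1 + θ / 2) = -1 + -θ + θ / 2 by ring, Real.rpow_add hp,
            Real.rpow_add hp]
          ring
  have hle := norm_integral_le_of_norm_le (hJint.const_mul _) (Eventually.of_forall hbound)
  rw [hint, integral_const_mul, norm_mul, norm_real, Real.norm_eq_abs] at hle
  have hpi : (1 : ℝ) ≤ ‖(2 * Real.pi : ℂ)‖ := by
    rw [norm_mul, norm_real, Real.norm_of_nonneg Real.pi_pos.le]
    have := Real.pi_gt_three
    norm_num
    linarith
  have hX : (1 : ℝ) ≤ ((N : ℝ) + 1) ^ (1 / 2 + ε) := Real.one_le_rpow (by linarith) (by linarith)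
  calc |chebyshevSum N - N| = |(chebyshevSum N - N + 1 / 2) - 1 / 2| := by congr 1; ring
    _ ≤ |chebyshevSum N - N + 1 / 2| + 1 / 2 := by
        refine (abs_sub _ _).trans ?_
        norm_num [abs_of_pos]
    _ ≤ 18 * C * ((N : ℝ) + 1) ^ (1 / 2 + ε) * J + ((N : ℝ) + 1) ^ (1 / 2 + ε) := by
        refine add_le_add (le_trans ?_ hle) (by linarith)
        exact le_mul_of_one_le_left (abs_nonneg _) hpi
    _ = _ := by ring

end PrimeNumberBound

/-! ### Averages of G and the two implications -/

section Goldbach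

open ArithmeticFunction

lemma goldbachG_zero : goldbachG 0 = 0 := by simp [goldbachG]

lemma sum_Icc_one_eq_sum_range {f : ℕ → ℝ} (hf : f 0 = 0) (N : ℕ) :
    ∑ n ∈ Finset.Icc 1 N, f n = ∑ n ∈ Finset.range (N + 1), f n := by
  rw [Finset.sum_range_succ', hf, add_zero, Finset.range_eq_Ico, Finset.sum_Ico_add' f 0 N 1]
  rfl

lemma sum_range_goldbachG (N : ℕ) :
    ∑ n ∈ Finset.range (N + 1), goldbachG n
      = ∑ m ∈ Finset.range (N + 1), vonMangoldt m * chebyshevSum (N - m) := by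
  have h1 : ∀ n, goldbachG n = ∑ k ∈ Finset.range (n + 1), vonMangoldt k * vonMangoldt (n - k) :=
    fun n => Finset.Nat.sum_antidiagonal_eq_sum_range_succ
      (fun i j => vonMangoldt i * vonMangoldt j) n
  simp only [h1]
  rw [Finset.sum_range_diag_flip (N + 1) fun k j => vonMangoldt k * vonMangoldt j]
  refine Finset.sum_congr rfl fun m hm => ?_
  rw [chebyshevSum, Finset.mul_sum, Nat.sub_add_comm (Nat.lt_succ_iff.1 (Finset.mem_range.1 hm))]

/-- The Riesz mean telescopes into values of ψ, so the estimate for ψ can be used a second time. -/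
lemma sum_range_vonMangoldt_mul_sub (N : ℕ) :
    ∑ m ∈ Finset.range (N + 1), vonMangoldt m * ((N : ℝ) - m)
      = ∑ k ∈ Finset.range N, chebyshevSum k := by
  have h : ∀ M, mangoldtRiesz M = ∑ k ∈ Finset.range M, chebyshevSum k := by
    intro M
    induction M with
    | zero => simp [mangoldtRiesz]
    | succ M ih => rw [Finset.sum_range_succ, ← ih, ← mangoldtRiesz_succ_sub]; ring
  rw [← h, Finset.sum_range_succ, mangoldtRiesz, sub_self, mul_zero, add_zero]

lemma sum_range_cast (N : ℕ) : ∑ k ∈ Finset.range N, (k : ℝ) = N * (N - 1) / 2 := by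
  induction N with
  | zero => simp
  | succ N ih => rw [Finset.sum_range_succ, ih]; push_cast; ring

/-- The average order of `G` from the prime number theorem with error `O(N^{1/2 + ε})`. -/
lemma abs_sum_range_goldbachG_sub_le {ε C : ℝ} (hε : 0 ≤ ε) (hε1 : ε ≤ 1 / 2) (hC : 0 ≤ C)
    (h : ∀ N : ℕ, |chebyshevSum N - N| ≤ C * ((N : ℝ) + 1) ^ (1 / 2 + ε)) (N : ℕ) :
    |∑ n ∈ Finset.range (N + 1), goldbachG n - (N : ℝ) * (N - 1) / 2|
      ≤ C * (C + 2) * ((N : ℝ) + 1) ^ (3 / 2 + ε) := by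
  set X : ℝ := (N : ℝ) + 1 with hX
  have hX1 : 1 ≤ X := by rw [hX]; linarith [Nat.cast_nonneg (α := ℝ) N]
  have hmono : ∀ k : ℕ, k ≤ N → C * ((k : ℝ) + 1) ^ (1 / 2 + ε) ≤ C * X ^ (1 / 2 + ε) := by
    intro k hk
    have : (k : ℝ) ≤ N := by exact_mod_cast hk
    rw [hX]
    gcongr
  have hXle : X ^ (1 / 2 + ε) ≤ X := by
    conv_rhs => rw [← Real.rpow_one X]
    exact Real.rpow_le_rpow_of_exponent_le hX1 (by linarith)
  have hXmul : X * X ^ (1 / 2 + ε) = X ^ (3 / 2 + ε) := by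
    rw [show 3 / 2 + ε = 1 + (1 / 2 + ε) by ring, Real.rpow_add (by linarith) 1, Real.rpow_one]
  have hψ : chebyshevSum N ≤ (C + 1) * X := by
    have := (abs_le.1 ((h N).trans (hmono N le_rfl))).2
    have h2 : C * X ^ (1 / 2 + ε) ≤ C * X := mul_le_mul_of_nonneg_left hXle hC
    have : (N : ℝ) ≤ X := by linarith
    linarith
  have h1 : |∑ m ∈ Finset.range (N + 1), vonMangoldt m * (chebyshevSum (N - m) - ((N : ℝ) - m))|
      ≤ (C + 1) * X * (C * X ^ (1 / 2 + ε)) := by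
    refine (Finset.abs_sum_le_sum_abs _ _).trans ?_
    calc _ ≤ ∑ m ∈ Finset.range (N + 1), vonMangoldt m * (C * X ^ (1 / 2 + ε)) := by
          refine Finset.sum_le_sum fun m hm => ?_
          have hm' : m ≤ N := Nat.lt_succ_iff.1 (Finset.mem_range.1 hm)
          have h3 := (h (N - m)).trans (hmono (N - m) (Nat.sub_le N m))
          rw [Nat.cast_sub hm'] at h3
          rw [abs_mul, abs_of_nonneg vonMangoldt_nonneg]
          exact mul_le_mul_of_nonneg_left h3 vonMangoldt_nonneg
      _ = chebyshevSum N * (C * X ^ (1 / 2 + ε)) := by rw [chebyshevSum, Finset.sum_mul]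
      _ ≤ _ := by gcongr
  have h2 : |∑ k ∈ Finset.range N, (chebyshevSum k - k)| ≤ X * (C * X ^ (1 / 2 + ε)) := by
    refine (Finset.abs_sum_le_sum_abs _ _).trans ?_
    calc _ ≤ ∑ k ∈ Finset.range N, C * X ^ (1 / 2 + ε) := Finset.sum_le_sum fun k hk =>
          (h k).trans (hmono k (Finset.mem_range.1 hk).le)
      _ = N * (C * X ^ (1 / 2 + ε)) := by simp
      _ ≤ _ := by gcongr; linarith
  -- The two errors come from ψ(N-m) → N-m, weighted by Λ(m), and from ψ(k) → k. They contribute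
  -- (C+1)C and C, together C(C+2).
  have e : ∑ n ∈ Finset.range (N + 1), goldbachG n - (N : ℝ) * (N - 1) / 2
      = ∑ m ∈ Finset.range (N + 1), vonMangoldt m * (chebyshevSum (N - m) - ((N : ℝ) - m))
        + ∑ k ∈ Finset.range N, (chebyshevSum k - k) := by
    rw [sum_range_goldbachG, Finset.sum_sub_distrib, sum_range_cast,
      ← sum_range_vonMangoldt_mul_sub]
    simp only [mul_sub, Finset.sum_sub_distrib]
    ring
  rw [e, ← hXmul]
  refine (abs_add_le _ _).trans ((add_le_add h1 h2).trans_eq ?_)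
  ring

lemma riemannZeta₁_ne_zero_of_riemannHypothesis (h : RiemannHypothesis) {s : ℂ}
    (hs : 1 / 2 < s.re) : riemannZeta₁ s ≠ 0 := by
  rcases eq_or_ne s 1 with rfl | hs1
  · simp
  intro h0
  have hζ : riemannZeta s = 0 := by rw [riemannZeta_eq_inv_sub_mul hs1, h0, mul_zero]
  refine hs.ne' (h s hζ ?_ hs1)
  rintro ⟨n, rfl⟩
  simp at hs
  linarith [Nat.cast_nonneg (α := ℝ) n]

lemma sum_goldbachG_sub_isBigO_of_riemannHypothesis (h : RiemannHypothesis) {ε : ℝ} (hε : 0 < ε) :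
    (fun x : ℝ => ∑ n ∈ Finset.Icc 1 ⌊x⌋₊, (goldbachG n - hardyLittlewoodJ n))
      =O[atTop] fun x : ℝ => x ^ ((3 : ℝ) / 2 + ε) := by
  -- Small ε is needed so that N^{1/2+ε'} ≤ N in the Goldbach estimate; larger ε only weakens the
  -- claim.
  set ε' := min ε (1 / 2) with hε'
  have hε0 : 0 < ε' := lt_min hε (by norm_num)
  have hεε : ε' ≤ ε := min_le_left _ _
  have hε1 : ε' ≤ 1 / 2 := min_le_right _ _
  obtain ⟨C, hC, hψ⟩ := exists_abs_chebyshevSum_sub_le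
    (fun s hs => riemannZeta₁_ne_zero_of_riemannHypothesis h hs) hε0 (by linarith)
  obtain ⟨D, hD⟩ := exists_abs_sum_hardyLittlewoodJ_sub_le
  refine IsBigO.of_bound (C * (C + 2) * 2 ^ (3 / 2 + ε') + 1 + |D|) ?_
  filter_upwards [eventually_ge_atTop 1] with x hx
  set N := ⌊x⌋₊
  have hNx : (N : ℝ) ≤ x := Nat.floor_le (by linarith)
  have hN0 : (0 : ℝ) ≤ N := Nat.cast_nonneg N
  have h1 := abs_sum_range_goldbachG_sub_le hε0.le hε1 hC hψ N
  have h2 := hD N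
  have p1 : ((N : ℝ) + 1) ^ (3 / 2 + ε') ≤ 2 ^ (3 / 2 + ε') * x ^ (3 / 2 + ε) := by
    calc ((N : ℝ) + 1) ^ (3 / 2 + ε') ≤ (2 * x) ^ (3 / 2 + ε') :=
          Real.rpow_le_rpow (by linarith) (by linarith) (by linarith)
      _ = 2 ^ (3 / 2 + ε') * x ^ (3 / 2 + ε') := Real.mul_rpow (by norm_num) (by linarith)
      _ ≤ _ := by gcongr
  have p2 : (N : ℝ) ≤ x ^ (3 / 2 + ε) := by
    refine hNx.trans ?_
    conv_lhs => rw [← Real.rpow_one x]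
    exact Real.rpow_le_rpow_of_exponent_le hx (by linarith)
  have p3 : (N : ℝ) ^ (3 / 2 : ℝ) ≤ x ^ (3 / 2 + ε) :=
    (Real.rpow_le_rpow hN0 hNx (by norm_num)).trans
      (Real.rpow_le_rpow_of_exponent_le hx (by linarith))
  have hx0 : 0 ≤ x ^ (3 / 2 + ε) := by positivity
  rw [Finset.sum_sub_distrib, sum_Icc_one_eq_sum_range goldbachG_zero, Real.norm_eq_abs,
    Real.norm_of_nonneg hx0]
  set SG := ∑ n ∈ Finset.range (N + 1), goldbachG n
  set SJ := ∑ n ∈ Finset.Icc 1 N, hardyLittlewoodJ n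
  calc |SG - SJ| = |(SG - (N : ℝ) * (N - 1) / 2) + (-(N : ℝ) / 2) - (SJ - (N : ℝ) ^ 2 / 2)| := by
        congr 1; ring
    _ ≤ |SG - (N : ℝ) * (N - 1) / 2| + |-(N : ℝ) / 2| + |SJ - (N : ℝ) ^ 2 / 2| :=
        (abs_sub _ _).trans (by gcongr; exact abs_add_le _ _)
    _ ≤ C * (C + 2) * (2 ^ (3 / 2 + ε') * x ^ (3 / 2 + ε)) + x ^ (3 / 2 + ε)
        + |D| * x ^ (3 / 2 + ε) := by
        refine add_le_add (add_le_add (h1.trans (by gcongr)) ?_) (h2.trans ?_)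
        · rw [abs_div, abs_neg, abs_of_nonneg hN0, abs_two]
          linarith
        · exact mul_le_mul (le_abs_self D) p3 (by positivity) (abs_nonneg D)
    _ = _ := by ring

lemma riemannHypothesis_of_sum_goldbachG_sub_isBigO
    (h : ∀ ε : ℝ, 0 < ε →
      (fun x : ℝ => ∑ n ∈ Finset.Icc 1 ⌊x⌋₊, (goldbachG n - hardyLittlewoodJ n))
        =O[atTop] fun x : ℝ => x ^ ((3 : ℝ) / 2 + ε)) : RiemannHypothesis := by
  refine riemannHypothesis_of_ne_zero fun s hs => riemannZeta₁_ne_zero_of_isBigO (fun c hc => ?_) hs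
  obtain ⟨D, hD⟩ := exists_abs_sum_hardyLittlewoodJ_sub_le
  have h1 : (fun N : ℕ => ∑ n ∈ Finset.Icc 1 N, (goldbachG n - hardyLittlewoodJ n))
      =O[atTop] fun N : ℕ => (N : ℝ) ^ (1 + c) := by
    have := (h (c - 1 / 2) (by linarith)).comp_tendsto (tendsto_natCast_atTop_atTop (R := ℝ))
    refine (this.congr (fun N => ?_) fun N => ?_)
    · simp
    · simp only [Function.comp]; congr 1; ring
  -- Abel summation needs a bound for every N, not just eventually. This is automatic because
  -- N^{1+c} vanishes only at N = 0, where the sum is empty.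
  obtain ⟨B, hB⟩ := (isBigO_nat_atTop_iff fun N hN => by
    have : N = 0 := by
      by_contra hne
      have : (0 : ℝ) < N := by exact_mod_cast Nat.pos_of_ne_zero hne
      exact (Real.rpow_pos_of_pos this _).ne' hN
    simp [this]).1 h1
  have key := expSeries_mangoldtSubOne_isBigO (c := 1 + c) (C := |B| + |D| + 1) (by linarith)
    (by positivity) fun N => ?_
  · simpa using key
  have hN0 : (0 : ℝ) ≤ N := Nat.cast_nonneg N
  have h2 := hB N
  rw [Finset.sum_sub_distrib, sum_Icc_one_eq_sum_range goldbachG_zero, Real.norm_eq_abs,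
    Real.norm_of_nonneg (by positivity)] at h2
  rw [Finset.sum_sub_distrib, sum_range_cast]
  have hpow : ∀ a : ℝ, 0 < a → a ≤ 1 + c → (N : ℝ) ^ a ≤ (N : ℝ) ^ (1 + c) := by
    intro a ha hac
    rcases Nat.eq_zero_or_pos N with rfl | hN
    · simp [Real.zero_rpow ha.ne', Real.zero_rpow (by linarith : 1 + c ≠ 0)]
    · exact Real.rpow_le_rpow_of_exponent_le (by exact_mod_cast hN) hac
  have p2 : (N : ℝ) ≤ (N : ℝ) ^ (1 + c) := by simpa using hpow 1 one_pos (by linarith)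
  have p3 := hpow (3 / 2) (by norm_num) (by linarith)
  set SG := ∑ n ∈ Finset.range (N + 1), goldbachG n
  set SJ := ∑ n ∈ Finset.Icc 1 N, hardyLittlewoodJ n
  -- The comparison sum of n over n ≤ N is N(N+1)/2, which exceeds N²/2 by N/2.
  calc |SG - ((N + 1 : ℕ) : ℝ) * (((N + 1 : ℕ) : ℝ) - 1) / 2|
      = |(SG - SJ) + (SJ - (N : ℝ) ^ 2 / 2) + (-(N : ℝ) / 2)| := by
        congr 1; push_cast; ring
    _ ≤ |SG - SJ| + |SJ - (N : ℝ) ^ 2 / 2| + |-(N : ℝ) / 2| :=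
        (abs_add_le _ _).trans (by gcongr; exact abs_add_le _ _)
    _ ≤ |B| * (N : ℝ) ^ (1 + c) + |D| * (N : ℝ) ^ (1 + c) + (N : ℝ) ^ (1 + c) := by
        refine add_le_add (add_le_add (h2.trans ?_) ((hD N).trans ?_)) ?_
        · exact mul_le_mul_of_nonneg_right (le_abs_self B) (by positivity)
        · exact mul_le_mul (le_abs_self D) p3 (by positivity) (abs_nonneg D)
        · rw [abs_div, abs_neg, abs_of_nonneg hN0, abs_two]
          linarith
    _ = _ := by ring

end Goldbach

theorem theorem2 :
    RiemannHypothesis ↔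
      ∀ ε : ℝ, 0 < ε →
        (fun x : ℝ => ∑ n ∈ Finset.Icc 1 ⌊x⌋₊, (goldbachG n - hardyLittlewoodJ n))
          =O[atTop] fun x : ℝ => x ^ ((3 : ℝ) / 2 + ε) :=
  ⟨fun h _ hε => sum_goldbachG_sub_isBigO_of_riemannHypothesis h hε,
    riemannHypothesis_of_sum_goldbachG_sub_isBigO⟩
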